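/- For $0<a<1/2$ let $$C_a=\Big\{(1-a)\sum_{j=0}^\infty \omega_j a^j:\ \omega_j\in\{0,1\}\text{ for all }j\Big\}$$ be the central Cantor set, let $d_a=\dim_H(C_a)$ be its Hausdorff dimension, and let $\mu_a$ be the distribution of the random sum $(1-a)\sum_{j=0}^\infty\omega_j a^j$, where the $\omega_j$ are independent with $\mathbf P(\omega_j=0)=\mathbf P(\omega_j=1)=1/2$. For $\lambda\in\mathbb R$ put $S_\lambda(x)=\lambda x$ and $\nu_{a,b}^\lambda=\mu_a*(\mu_b\circ S_\lambda^{-1})$. For a Borel probability measure $\nu$ on $\mathbb R$ let $\mathcal C_\nu(r)=\int\nu(B(x,r))\,d\nu(x)$, with $B(x,r)$ the closed ball. The lower and upper correlation dimensions $\underline D(\nu)$ and $\overline D(\nu)$ are the $\liminf$ and $\limsup$ of $\log\mathcal C_\nu(r)/\log r$ as $r\downarrow0$; if they coincide, the correlation dimension $D(\nu)$ exists and is their common value. The Hausdorff and packing dimensions of $\nu$ are $$\dim_H(\nu)=\inf\{\dim_H(E):\nu(\mathbb R\setminus E)=0\},\qquad \dim_P(\nu)=\inf\{\dim_P(E):\nu(\mathbb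 R\setminus E)=0\}.$$ Here the packing dimension of a set $E$ is $\dim_P(E)=\inf\sup_i\overline{\dim}_M(E_i)$, the infimum over all countable covers of $E$ by bounded sets $E_i$, where $\overline{\dim}_M(A)=\inf\{s\ge0:\lim_{\varepsilon\downarrow0}N(A,\varepsilon)\varepsilon^s=0\}$ is the upper Minkowski dimension and $N(A,\varepsilon)$ is the least number of closed balls of radius $\varepsilon$ that cover $A$. **Theorem.** Let $0<a,b<1/2$ be such that $\log b/\log a$ is irrational, and let $\lambda\neq0$. Then the correlation dimension of $\nu_{a,b}^\lambda$ exists and $$D(\nu_{a,b}^\lambda)=\dim_H(\nu_{a,b}^\lambda)=\dim_P(\nu_{a,b}^\lambda)=\min(d_a+d_b,1).$$ -/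

import Mathlib

open MeasureTheory Filter Topology
open scoped NNReal ENNReal

noncomputable section

/-- The sum `(1 - a) ∑_{j ≥ 0} ω_j a^j` attached to a sequence of digits `ω_j ∈ {0, 1}`. -/
def cantorSum (a : ℝ) (ω : ℕ → Fin 2) : ℝ :=
  (1 - a) * ∑' j : ℕ, ((ω j : ℕ) : ℝ) * a ^ j

/-- The central Cantor set `C_a`. -/
def centralCantorSet (a : ℝ) : Set ℝ := Set.range (cantorSum a)

/-- The law of a sequence of independent fair digits in `{0, 1}`. -/
def fairDigits : Measure (ℕ → Fin 2) :=
  Measure.infinitePi fun _ : ℕ => (PMF.uniformOfFintype (Fin 2)).toMeasure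

/-- The measure `μ_a`: the distribution of `(1 - a) ∑_{j ≥ 0} ω_j a^j` for independent fair
digits `ω_j`. -/
def cantorMeasure (a : ℝ) : Measure ℝ := fairDigits.map (cantorSum a)

/-- The measure `ν_{a,b}^t = μ_a * (μ_b ∘ S_t⁻¹)`, where `S_t x = t x`. -/
def cantorConv (a b t : ℝ) : Measure ℝ :=
  (cantorMeasure a).conv ((cantorMeasure b).map fun x => t * x)

section Dimensions

variable {X : Type*} [MetricSpace X] [MeasurableSpace X]

/-- The correlation integral `∫ ν(B(x, r)) dν(x)`, with closed balls. -/
def correlationIntegral (ν : Measure X) (r : ℝ) : ℝ≥0∞ :=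
  ∫⁻ x, ν (Metric.closedBall x r) ∂ν

/-- The lower correlation dimension `liminf_{r ↓ 0} log C_ν(r) / log r`. -/
def lowerCorrelationDim (ν : Measure X) : EReal :=
  liminf (fun r : ℝ => ENNReal.log (correlationIntegral ν r) / ((Real.log r : ℝ) : EReal))
    (𝓝[>] 0)

/-- The upper correlation dimension `limsup_{r ↓ 0} log C_ν(r) / log r`. -/
def upperCorrelationDim (ν : Measure X) : EReal :=
  limsup (fun r : ℝ => ENNReal.log (correlationIntegral ν r) / ((Real.log r : ℝ) : EReal))
    (𝓝[>] 0)

/-- The correlation dimension of `ν` exists and equals `d`. -/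
def HasCorrelationDim (ν : Measure X) (d : EReal) : Prop :=
  lowerCorrelationDim ν = d ∧ upperCorrelationDim ν = d

/-- The Hausdorff dimension of a measure: the infimum of `dim_H E` over sets `E` of full measure. -/
def measureHausdorffDim (ν : Measure X) : ℝ≥0∞ :=
  ⨅ (E : Set X) (_ : ν Eᶜ = 0), dimH E

end Dimensions

section Packing

variable {X : Type*} [MetricSpace X]

/-- The upper Minkowski (box-counting) dimension `inf {s ≥ 0 : lim_{ε ↓ 0} N(A, ε) ε^s = 0}`,
where `N(A, ε)` is the least number of closed `ε`-balls needed to cover `A`. -/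
def upperMinkowskiDim (A : Set X) : ℝ≥0∞ :=
  ⨅ (s : ℝ≥0)
    (_ : Tendsto
      (fun ε : ℝ≥0 =>
        ((Metric.externalCoveringNumber ε A : ℕ∞) : ℝ≥0∞) * (ε : ℝ≥0∞) ^ (s : ℝ))
      (𝓝[>] 0) (𝓝 0)),
    (s : ℝ≥0∞)

/-- The packing dimension of a set: the infimum, over countable covers of `A` by bounded sets, of
the supremum of the upper Minkowski dimensions of the pieces. -/
def packingDim (A : Set X) : ℝ≥0∞ :=
  ⨅ (F : ℕ → Set X) (_ : ∀ i, Bornology.IsBounded (F i)) (_ : A ⊆ ⋃ i, F i),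
    ⨆ i, upperMinkowskiDim (F i)

/-- The packing dimension of a measure: the infimum of `dim_P E` over sets `E` of full measure. -/
def measurePackingDim [MeasurableSpace X] (ν : Measure X) : ℝ≥0∞ :=
  ⨅ (E : Set X) (_ : ν Eᶜ = 0), packingDim E

end Packing

end

/-! ### Correlation integrals on the line: shifts, doubling, convolution. -/

section CorrelationIntegral

/-! Let `α = min (cantorDim a + cantorDim b) 1` and let `C_t(r)` be the correlation integral of
`cantorConv a b t`. One direction is box counting: the measure lives on `C_a + t C_b`, which is
covered by `O(ε^{-α})` intervals of radius `ε`. This bounds the packing dimension above by `α` and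
forces `C_t(r) ≥ c r^α`. Everything else follows from `C_t(r) = O(r^s)` for every `s < α`
(`exists_correlationIntegral_cantorConv_le`): for every set of full measure, `dimH` is then at least
`α`, by an energy argument and the mass distribution principle, and packing dimension dominates
Hausdorff dimension.

The power bound rests on three facts.

Submultiplicativity (`exists_correlationIntegral_cantorConv_mul_le`): fixing `n` digits of `μ_a` and
`m` digits of `μ_b` leaves a copy, scaled by `a^n`, of the measure with ratio `t b^m / a^n`. While
this ratio stays bounded, `C_t(a^n r) ≤ K C_t(a^n) C_{t b^m / a^n}(r)`. With the ratio written `t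
e^x` and `x` taken modulo `L = -log b`, iteration at step `a^N` bounds `C_t(a^{Nk})` by a product
along the orbit of the rotation by `-N log a`.

Uniform averaging (`exists_sum_rotation_le`): by AM-GM the product is at most the `k`-th power of
the arithmetic mean of its factors. The rotation is irrational, so this mean is bounded, from every
starting point, by a constant times the space average. Continuity is not needed, only constancy up
to a bounded factor at a small scale; the constant does not depend on `N`.

Transversality (`exists_setLIntegral_correlationIntegral_le`): as `x` varies, `t e^x (v - v')` moves
at speed comparable to `|v - v'|`, so the average of `C_{t e^x}(a^N)` over `x` is `O(N a^{αN})`.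

Each factor thus costs a constant times `(N + 1) a^{αN}`, which is below `a^{sN}` once `N` is large.
Uniformity in the starting point is what gives the result for every `t ≠ 0` and not merely for
almost every one. -/

/-- The shifted correlation integral `∫ η(B(x + s, r)) dη(x)`. -/
noncomputable def shiftedCorrelation (η : Measure ℝ) (s r : ℝ) : ℝ≥0∞ :=
  ∫⁻ x, η (Metric.closedBall (x + s) r) ∂η

lemma shiftedCorrelation_zero (η : Measure ℝ) (r : ℝ) :
    shiftedCorrelation η 0 r = correlationIntegral η r := by
  simp [shiftedCorrelation, correlationIntegral]

lemma measurable_measure_closedBall (η : Measure ℝ) [SFinite η] (r : ℝ) :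
    Measurable fun x : ℝ => η (Metric.closedBall x r) := by
  have hS : MeasurableSet {p : ℝ × ℝ | dist p.2 p.1 ≤ r} :=
    (isClosed_le (by fun_prop) continuous_const).measurableSet
  exact measurable_measure_prodMk_left hS

lemma measurable_shiftedCorrelation (η : Measure ℝ) [SFinite η] (r : ℝ) :
    Measurable fun s : ℝ => shiftedCorrelation η s r := by
  unfold shiftedCorrelation
  refine Measurable.lintegral_prod_right' (f := fun p : ℝ × ℝ => η (Metric.closedBall (p.2 + p.1) r))
    ?_
  exact (measurable_measure_closedBall η r).comp (by fun_prop)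

/-- The ball is centred at the integration variable, which is the form needed to exchange the order
of integration. -/
lemma measure_closedBall_eq_lintegral (η : Measure ℝ) (y r : ℝ) :
    η (Metric.closedBall y r)
      = ∫⁻ x, (Metric.closedBall x r).indicator (fun _ => (1 : ℝ≥0∞)) y ∂η := by
  rw [← lintegral_indicator_one (Metric.isClosed_closedBall.measurableSet)]
  refine lintegral_congr fun x => ?_
  by_cases h : dist x y ≤ r <;> simp [Set.indicator, h, dist_comm y x]

lemma measurable_indicator_closedBall {α : Type*} [MeasurableSpace α] {f g : α → ℝ}
    (hf : Measurable f) (hg : Measurable g) (r : ℝ) :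
    Measurable fun p : α => (Metric.closedBall (f p) r).indicator (fun _ => (1 : ℝ≥0∞)) (g p) := by
  have hS : MeasurableSet {p : ℝ × ℝ | dist p.2 p.1 ≤ r} :=
    (isClosed_le (by fun_prop) continuous_const).measurableSet
  exact (measurable_one.indicator hS).comp (hf.prodMk hg)

lemma measurable_measure_closedBall_comp (η : Measure ℝ) [SFinite η] {α : Type*}
    [MeasurableSpace α] {f : α → ℝ} (hf : Measurable f) (r : ℝ) :
    Measurable fun p : α => η (Metric.closedBall (f p) r) :=
  (measurable_measure_closedBall η r).comp hf

/-- Expand one factor as an integral over `x` with `|y - x| ≤ r`; there `B(y, r) ⊆ B(x, 2r)`.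
Integrating over `y` first leaves the length `2r` of `B(x, r)`. -/
lemma lintegral_measure_closedBall_sq_le (η : Measure ℝ) [SFinite η] (r : ℝ) :
    ∫⁻ y, η (Metric.closedBall y r) * η (Metric.closedBall y r)
      ≤ ENNReal.ofReal (2 * r) * correlationIntegral η (2 * r) := by
  calc ∫⁻ y, η (Metric.closedBall y r) * η (Metric.closedBall y r)
      ≤ ∫⁻ y, (∫⁻ x, (Metric.closedBall x r).indicator (fun _ => (1 : ℝ≥0∞)) y
          * η (Metric.closedBall x (2 * r)) ∂η) := by
        refine lintegral_mono fun y => ?_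
        dsimp only
        conv_lhs => rw [measure_closedBall_eq_lintegral η y r]
        rw [← lintegral_mul_const _ (measurable_indicator_closedBall measurable_id' measurable_const r)]
        refine lintegral_mono fun x => ?_
        by_cases h : y ∈ Metric.closedBall x r
        · rw [← measure_closedBall_eq_lintegral]
          gcongr
          refine Metric.closedBall_subset_closedBall' ?_
          rw [Metric.mem_closedBall] at h
          linarith
        · simp [Set.indicator, h]
    _ = ∫⁻ x, (∫⁻ y, (Metric.closedBall x r).indicator (fun _ => (1 : ℝ≥0∞)) y
          * η (Metric.closedBall x (2 * r))) ∂η := by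
        refine lintegral_lintegral_swap ?_
        refine Measurable.aemeasurable ?_
        exact (measurable_indicator_closedBall measurable_snd measurable_fst r).mul
          (measurable_measure_closedBall_comp η measurable_snd (2 * r))
    _ = ENNReal.ofReal (2 * r) * correlationIntegral η (2 * r) := by
        unfold correlationIntegral
        rw [← lintegral_const_mul _ (measurable_measure_closedBall η (2 * r))]
        refine lintegral_congr fun x => ?_
        rw [lintegral_mul_const _ (measurable_indicator_closedBall measurable_const measurable_id' r)]
        congr 1
        rw [lintegral_indicator Metric.isClosed_closedBall.measurableSet]
        simp

/-- If `x + s` and `x'` are within `r`, the points `y` that are `r`-close to both `x` and `x' - s`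
contain the interval of length `r` about their midpoint. Together with the preceding square bound
this replaces Cauchy–Schwarz for correlation integrals by an argument with Lebesgue measure, which
ignores shifts. -/
lemma ofReal_mul_shiftedCorrelation_le (η : Measure ℝ) [SFinite η] (s r : ℝ) :
    ENNReal.ofReal r * shiftedCorrelation η s r
      ≤ ∫⁻ y, η (Metric.closedBall y r) * η (Metric.closedBall (y + s) r) := by
  calc ENNReal.ofReal r * shiftedCorrelation η s r
      ≤ ∫⁻ x, (∫⁻ x', (∫⁻ y, (Metric.closedBall x r).indicator (fun _ => (1 : ℝ≥0∞)) y
          * (Metric.closedBall x' r).indicator (fun _ => (1 : ℝ≥0∞)) (y + s)) ∂η) ∂η := by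
        unfold shiftedCorrelation
        rw [← lintegral_const_mul _ (measurable_measure_closedBall_comp η (measurable_id'.add_const s) r)]
        refine lintegral_mono fun x => ?_
        dsimp only
        rw [measure_closedBall_eq_lintegral, ← lintegral_const_mul _ 
          (measurable_indicator_closedBall measurable_id' measurable_const r)]
        refine lintegral_mono fun x' => ?_
        by_cases h : x + s ∈ Metric.closedBall x' r
        · have hsub : Metric.closedBall ((x + x' - s) / 2) (r / 2) ⊆
              {y | y ∈ Metric.closedBall x r ∧ y + s ∈ Metric.closedBall x' r} := by
            intro y hy
            simp only [Metric.mem_closedBall, Real.dist_eq, abs_le, Set.mem_ofPred_eq] at hy h ⊢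
            constructor <;> constructor <;> linarith
          calc ENNReal.ofReal r * (Metric.closedBall x' r).indicator (fun _ => (1 : ℝ≥0∞)) (x + s)
              = ∫⁻ y, (Metric.closedBall ((x + x' - s) / 2) (r / 2)).indicator
                  (fun _ => (1 : ℝ≥0∞)) y := by
                rw [lintegral_indicator Metric.isClosed_closedBall.measurableSet]
                simp only [Set.indicator_of_mem h, lintegral_const, MeasurableSet.univ,
                  Measure.restrict_apply, Set.univ_inter, Real.volume_closedBall, one_mul, mul_one]
                congr 1; ring
            _ ≤ _ := by
                refine lintegral_mono fun y => ?_
                by_cases hy : y ∈ Metric.closedBall ((x + x' - s) / 2) (r / 2)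
                · have := hsub hy
                  rw [Set.indicator_of_mem hy, Set.indicator_of_mem this.1,
                    Set.indicator_of_mem this.2, one_mul]
                · rw [Set.indicator_of_notMem hy]; exact zero_le
        · simp [Set.indicator_of_notMem h]
    _ = ∫⁻ x, (∫⁻ y, (Metric.closedBall x r).indicator (fun _ => (1 : ℝ≥0∞)) y
          * η (Metric.closedBall (y + s) r)) ∂η := by
        refine lintegral_congr fun x => ?_
        rw [lintegral_lintegral_swap]
        · refine lintegral_congr fun y => ?_
          rw [lintegral_const_mul _
            (measurable_indicator_closedBall measurable_id' measurable_const r),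
            ← measure_closedBall_eq_lintegral]
        · exact ((measurable_indicator_closedBall measurable_const measurable_snd r).mul
            (measurable_indicator_closedBall measurable_fst
              (measurable_snd.add_const s) r)).aemeasurable
    _ = ∫⁻ y, (∫⁻ x, (Metric.closedBall x r).indicator (fun _ => (1 : ℝ≥0∞)) y
          * η (Metric.closedBall (y + s) r) ∂η) := by
        refine lintegral_lintegral_swap (Measurable.aemeasurable ?_)
        exact (measurable_indicator_closedBall measurable_fst measurable_snd r).mul
          (measurable_measure_closedBall_comp η (measurable_snd.add_const s) r)
    _ = _ := by
        refine lintegral_congr fun y => ?_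
        rw [lintegral_mul_const _ (measurable_indicator_closedBall measurable_id' measurable_const r),
          ← measure_closedBall_eq_lintegral]

/-- A shift increases the correlation integral by at most a constant, after doubling the radius. -/
lemma shiftedCorrelation_le (η : Measure ℝ) [SFinite η] (s : ℝ) {r : ℝ} (hr : 0 < r) :
    shiftedCorrelation η s r ≤ 4 * correlationIntegral η (2 * r) := by
  have hmb := measurable_measure_closedBall η r
  have h1 := ofReal_mul_shiftedCorrelation_le η s r
  -- A product is at most the sum of the two squares, and both squares have the same Lebesgue
  -- integral by translation invariance.
  have h2 : ∫⁻ y, η (Metric.closedBall y r) * η (Metric.closedBall (y + s) r)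
      ≤ 2 * ∫⁻ y, η (Metric.closedBall y r) * η (Metric.closedBall y r) := by
    calc _ ≤ ∫⁻ y, (η (Metric.closedBall y r) * η (Metric.closedBall y r)
          + η (Metric.closedBall (y + s) r) * η (Metric.closedBall (y + s) r)) := by
          refine lintegral_mono fun y => ?_
          rcases le_total (η (Metric.closedBall y r)) (η (Metric.closedBall (y + s) r)) with h | h
          · exact le_add_left (by gcongr)
          · exact le_add_right (by gcongr)
      _ = _ := by
          rw [lintegral_add_left (by exact hmb.mul hmb), two_mul]
          congr 1
          exact lintegral_add_right_eq_self
            (fun y => η (Metric.closedBall y r) * η (Metric.closedBall y r)) s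
  have h3 := lintegral_measure_closedBall_sq_le η r
  have h4 : ENNReal.ofReal r * shiftedCorrelation η s r
      ≤ ENNReal.ofReal r * (4 * correlationIntegral η (2 * r)) := by
    refine h1.trans (h2.trans ((mul_le_mul_right h3 2).trans (le_of_eq ?_)))
    rw [ENNReal.ofReal_mul zero_le_two, ENNReal.ofReal_ofNat]
    ring
  exact (ENNReal.mul_le_mul_iff_right (by simpa using hr) ENNReal.ofReal_ne_top).1 h4

lemma correlationIntegral_mono (η : Measure ℝ) {r r' : ℝ} (h : r ≤ r') :
    correlationIntegral η r ≤ correlationIntegral η r' :=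
  lintegral_mono fun _ => measure_mono (Metric.closedBall_subset_closedBall h)

lemma correlationIntegral_le_one (η : Measure ℝ) [IsProbabilityMeasure η] (r : ℝ) :
    correlationIntegral η r ≤ 1 :=
  (lintegral_mono fun _ => prob_le_one).trans (by simp)

/-- A ball of radius `2r` is a union of four balls of radius `r / 2` with shifted centres, and the
shift bound costs a factor 4 for each while bringing the radius back to `r`. No doubling assumption
on the measure is needed. -/
lemma correlationIntegral_two_mul_le (η : Measure ℝ) [SFinite η] {r : ℝ} (hr : 0 < r) :
    correlationIntegral η (2 * r) ≤ 16 * correlationIntegral η r := by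
  have hms : ∀ s : ℝ, Measurable fun x : ℝ => η (Metric.closedBall (x + s) (r / 2)) := fun s =>
    measurable_measure_closedBall_comp η (measurable_id'.add_const s) _
  have hle : correlationIntegral η (2 * r) ≤
      shiftedCorrelation η (-(3 * r / 2)) (r / 2) + shiftedCorrelation η (-(r / 2)) (r / 2)
      + (shiftedCorrelation η (r / 2) (r / 2) + shiftedCorrelation η (3 * r / 2) (r / 2)) := by
    unfold shiftedCorrelation correlationIntegral
    rw [← lintegral_add_left (hms _), ← lintegral_add_left (hms _),
      ← lintegral_add_left (by exact (hms _).add (hms _))]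
    refine lintegral_mono fun x => ?_
    refine le_trans (measure_mono (t := (Metric.closedBall (x + -(3 * r / 2)) (r / 2) ∪
      Metric.closedBall (x + -(r / 2)) (r / 2)) ∪ (Metric.closedBall (x + r / 2) (r / 2) ∪
      Metric.closedBall (x + 3 * r / 2) (r / 2))) ?_) ?_
    · intro y hy
      simp only [Metric.mem_closedBall, Real.dist_eq, abs_le, Set.mem_union] at hy ⊢
      rcases le_total y x with h | h
      · rcases le_total y (x - r) with h' | h'
        · exact .inl (.inl ⟨by linarith, by linarith⟩)
        · exact .inl (.inr ⟨by linarith, by linarith⟩)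
      · rcases le_total y (x + r) with h' | h'
        · exact .inr (.inl ⟨by linarith, by linarith⟩)
        · exact .inr (.inr ⟨by linarith, by linarith⟩)
    · exact (measure_union_le _ _).trans
        (add_le_add (measure_union_le _ _) (measure_union_le _ _))
  have hs : ∀ s, shiftedCorrelation η s (r / 2) ≤ 4 * correlationIntegral η r := fun s => by
    have := shiftedCorrelation_le η s (half_pos hr)
    rwa [mul_div_cancel₀ r two_ne_zero] at this
  refine hle.trans ((add_le_add (add_le_add (hs _) (hs _)) (add_le_add (hs _) (hs _))).trans ?_)
  ring_nf
  exact le_rfl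

lemma correlationIntegral_two_pow_mul_le (η : Measure ℝ) [SFinite η] (n : ℕ) {r : ℝ}
    (hr : 0 < r) :
    correlationIntegral η (2 ^ n * r) ≤ 16 ^ n * correlationIntegral η r := by
  induction n with
  | zero => simp
  | succ n ih =>
    calc correlationIntegral η (2 ^ (n + 1) * r) = correlationIntegral η (2 * (2 ^ n * r)) := by
          congr 1; ring
      _ ≤ 16 * (16 ^ n * correlationIntegral η r) :=
          (correlationIntegral_two_mul_le η (by positivity)).trans (by gcongr)
      _ = _ := by ring

lemma shiftedCorrelation_le_correlationIntegral (η : Measure ℝ) [SFinite η] (s : ℝ) {r : ℝ}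
    (hr : 0 < r) : shiftedCorrelation η s r ≤ 64 * correlationIntegral η r := by
  refine (shiftedCorrelation_le η s hr).trans
    ((mul_le_mul_right (correlationIntegral_two_mul_le η hr) 4).trans (le_of_eq ?_))
  ring

lemma correlationIntegral_conv (ρ η : Measure ℝ) [SFinite ρ] [SFinite η] (r : ℝ) :
    correlationIntegral (ρ ∗ η) r = ∫⁻ z, ∫⁻ z', shiftedCorrelation η (z - z') r ∂ρ ∂ρ := by
  have hmb := measurable_measure_closedBall η r
  have hball : ∀ x, (ρ ∗ η) (Metric.closedBall x r)
      = ∫⁻ z', η (Metric.closedBall (x - z') r) ∂ρ := by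
    intro x
    rw [Measure.conv, Measure.map_apply measurable_add Metric.isClosed_closedBall.measurableSet,
      Measure.prod_apply (measurable_add Metric.isClosed_closedBall.measurableSet)]
    refine lintegral_congr fun z' => ?_
    congr 1
    ext y
    simp only [Set.mem_preimage, Metric.mem_closedBall, Real.dist_eq]
    rw [show z' + y - x = y - (x - z') by ring]
  unfold correlationIntegral
  rw [Measure.lintegral_conv (measurable_measure_closedBall _ r)]
  refine lintegral_congr fun z => ?_
  simp_rw [hball]
  rw [lintegral_lintegral_swap]
  · refine lintegral_congr fun z' => ?_
    unfold shiftedCorrelation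
    refine lintegral_congr fun w => ?_
    congr 2; ring
  · exact (hmb.comp (by fun_prop : Measurable fun p : ℝ × ℝ => z + p.1 - p.2)).aemeasurable

lemma shiftedCorrelation_eq_zero {η : Measure ℝ} {D s r : ℝ}
    (hD : ∀ᵐ x ∂η, ∀ᵐ y ∂η, |y - x| ≤ D) (h : r + D < |s|) :
    shiftedCorrelation η s r = 0 := by
  unfold shiftedCorrelation
  refine (lintegral_congr_ae ?_).trans lintegral_zero
  filter_upwards [hD] with x hx
  refine measure_mono_null (fun y hy => ?_) hx
  simp only [Metric.mem_closedBall, Real.dist_eq, Set.mem_compl_iff, Set.mem_ofPred_eq] at hy ⊢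
  intro hxy
  have : |s| ≤ |y - x| + |y - (x + s)| := by
    rw [show s = (y - x) - (y - (x + s)) by ring]
    refine (abs_sub _ _).trans ?_
    rw [show (y - x) - (y - (x + s)) = s by ring]
  linarith

/-- The correlation integral of a convolution with a measure of bounded support is controlled by
the correlation integrals of the two factors, at a large and a small scale. -/
lemma correlationIntegral_conv_le (ρ η : Measure ℝ) [SFinite ρ] [SFinite η] {D r : ℝ}
    (hr : 0 < r) (hD : ∀ᵐ x ∂η, ∀ᵐ y ∂η, |y - x| ≤ D) :
    correlationIntegral (ρ ∗ η) r
      ≤ 64 * correlationIntegral ρ (r + D) * correlationIntegral η r := by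
  rw [correlationIntegral_conv, mul_right_comm]
  rw [correlationIntegral.eq_1 ρ, ← lintegral_const_mul _ (measurable_measure_closedBall ρ _)]
  refine lintegral_mono fun z => ?_
  dsimp only
  rw [measure_closedBall_eq_lintegral ρ z, ← lintegral_const_mul _
    (measurable_indicator_closedBall measurable_id' measurable_const _)]
  refine lintegral_mono fun z' => ?_
  -- Only pairs at distance at most `r + D` contribute, and they carry the correlation integral of
  -- `ρ` at that scale; for them the shift is absorbed by the factor 64.
  by_cases h : z ∈ Metric.closedBall z' (r + D)
  · simpa [Set.indicator_of_mem h] using shiftedCorrelation_le_correlationIntegral η (z - z') hr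
  · rw [Metric.mem_closedBall, Real.dist_eq, not_le] at h
    simp [shiftedCorrelation_eq_zero hD h]

lemma correlationIntegral_conv_le' (ρ η : Measure ℝ) [IsProbabilityMeasure ρ] [SFinite η] {r : ℝ}
    (hr : 0 < r) :
    correlationIntegral (ρ ∗ η) r ≤ 64 * correlationIntegral η r := by
  rw [correlationIntegral_conv]
  calc _ ≤ ∫⁻ _, ∫⁻ _, 64 * correlationIntegral η r ∂ρ ∂ρ := lintegral_mono fun z =>
        lintegral_mono fun z' => shiftedCorrelation_le_correlationIntegral η _ hr
    _ = _ := by simp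

/-- Adding increments of spread at most `D` moves a pair at distance `r` to one at distance at most
`r + D`. This passes from the coarse factor `ρ` back to the whole measure. -/
lemma correlationIntegral_le_conv (ρ η : Measure ℝ) [SFinite ρ] [IsProbabilityMeasure η]
    {D r : ℝ} (hD : ∀ᵐ x ∂η, ∀ᵐ y ∂η, |y - x| ≤ D) :
    correlationIntegral ρ r ≤ correlationIntegral (ρ ∗ η) (r + D) := by
  rw [correlationIntegral_conv]
  unfold correlationIntegral
  refine lintegral_mono fun z => ?_
  dsimp only
  rw [measure_closedBall_eq_lintegral ρ z]
  refine lintegral_mono fun z' => ?_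
  by_cases h : z ∈ Metric.closedBall z' r
  · rw [Set.indicator_of_mem h]
    unfold shiftedCorrelation
    refine le_trans (by simp : (1 : ℝ≥0∞) ≤ ∫⁻ _, 1 ∂η) (lintegral_mono_ae ?_)
    filter_upwards [hD] with x hx
    rw [← measure_univ (μ := η)]
    refine measure_mono_ae ?_
    filter_upwards [hx] with y hy _
    change dist y (x + (z - z')) ≤ r + D
    rw [Metric.mem_closedBall, Real.dist_eq] at h
    rw [Real.dist_eq, show y - (x + (z - z')) = (y - x) - (z - z') by ring, add_comm]
    exact (abs_sub _ _).trans (add_le_add hy h)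
  · simp [Set.indicator_of_notMem h]

lemma correlationIntegral_map_mul (η : Measure ℝ) [SFinite η] {δ : ℝ} (hδ : 0 < δ) (r : ℝ) :
    correlationIntegral (η.map fun x => δ * x) (δ * r) = correlationIntegral η r := by
  unfold correlationIntegral
  have hm : Measurable fun x : ℝ => δ * x := by fun_prop
  rw [lintegral_map (measurable_measure_closedBall _ _) hm]
  refine lintegral_congr fun x => ?_
  rw [Measure.map_apply hm Metric.isClosed_closedBall.measurableSet]
  congr 1
  ext y
  simp only [Set.mem_preimage, Metric.mem_closedBall, Real.dist_eq]
  rw [← mul_sub, abs_mul, abs_of_pos hδ, mul_le_mul_iff_right₀ hδ]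

end CorrelationIntegral

/-! ### Self-similarity and Frostman regularity of the Cantor measure. -/

section CantorMeasure

variable {a : ℝ}

/-- Prepend a digit to a sequence of digits. -/
def consDigit (p : Fin 2 × (ℕ → Fin 2)) : ℕ → Fin 2 := fun n => Nat.casesOn n p.1 p.2

lemma measurable_consDigit : Measurable consDigit := by
  refine measurable_pi_lambda _ fun n => ?_
  cases n with
  | zero => exact measurable_fst
  | succ n => exact (measurable_pi_apply n).comp measurable_snd

instance : IsProbabilityMeasure fairDigits := by unfold fairDigits; infer_instance

/-- An infinite product measure is determined by its cylinders. Enlarging the index set to an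
initial segment, with full factors at the new indices, lets the coordinate `0` be split off. -/
lemma fairDigits_eq_map_consDigit :
    fairDigits = (((PMF.uniformOfFintype (Fin 2)).toMeasure).prod fairDigits).map consDigit := by
  classical
  symm
  unfold fairDigits
  refine Measure.eq_infinitePi _ fun s t ht => ?_
  obtain ⟨n, hn⟩ : ∃ n, s ⊆ Finset.range (n + 1) := by
    obtain ⟨n, hn⟩ := s.exists_nat_subset_range
    exact ⟨n, hn.trans (Finset.range_mono n.le_succ)⟩
  let t' : ℕ → Set (Fin 2) := fun i => if i ∈ s then t i else Set.univ
  have ht' : ∀ i, MeasurableSet (t' i) := fun i => MeasurableSet.of_discrete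
  have h1 : Set.pi (s : Set ℕ) t = Set.pi (Finset.range (n + 1) : Set ℕ) t' := by
    ext x
    simp only [Set.mem_pi, Finset.mem_coe, t']
    constructor
    · intro h i _
      by_cases his : i ∈ s
      · simpa [his] using h i his
      · simp [his]
    · intro h i his
      simpa [his] using h i (hn his)
  have h2 : ∏ i ∈ s, (PMF.uniformOfFintype (Fin 2)).toMeasure (t i)
      = ∏ i ∈ Finset.range (n + 1), (PMF.uniformOfFintype (Fin 2)).toMeasure (t' i) := by
    rw [← Finset.prod_subset hn]
    · exact Finset.prod_congr rfl fun i hi => by simp [t', hi]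
    · intro i _ hi
      simp [t', hi]
  have h3 : consDigit ⁻¹' Set.pi (Finset.range (n + 1) : Set ℕ) t'
      = t' 0 ×ˢ Set.pi (Finset.range n : Set ℕ) fun i => t' (i + 1) := by
    ext p
    simp only [Set.mem_preimage, Set.mem_pi, Finset.mem_coe, Finset.mem_range, Set.mem_prod]
    constructor
    · exact fun h => ⟨h 0 (by omega), fun i hi => h (i + 1) (by omega)⟩
    · rintro ⟨h0, hs⟩ i hi
      cases i with
      | zero => exact h0
      | succ i => exact hs i (by omega)
  rw [h1, h2, Measure.map_apply measurable_consDigit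
    (MeasurableSet.pi (Finset.countable_toSet _) fun i _ => ht' i), h3, Measure.prod_prod,
    Measure.infinitePi_pi _ fun i _ => ht' _, Finset.prod_range_succ', mul_comm]

lemma summable_digits (ha : 0 < a) (ha' : a < 1 / 2) (ω : ℕ → Fin 2) :
    Summable fun j : ℕ => ((ω j : ℕ) : ℝ) * a ^ j := by
  refine Summable.of_nonneg_of_le (fun j => by positivity) (fun j => ?_)
    (summable_geometric_of_lt_one ha.le (by linarith))
  have : ((ω j : ℕ) : ℝ) ≤ 1 := by exact_mod_cast Nat.lt_succ_iff.1 (ω j).2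
  exact mul_le_of_le_one_left (by positivity) this

lemma cantorSum_eq (ha : 0 < a) (ha' : a < 1 / 2) (ω : ℕ → Fin 2) :
    cantorSum a ω = (1 - a) * ((ω 0 : ℕ) : ℝ) + a * cantorSum a fun n => ω (n + 1) := by
  unfold cantorSum
  rw [(summable_digits ha ha' ω).tsum_eq_zero_add]
  have : ∀ j, ((ω (j + 1) : ℕ) : ℝ) * a ^ (j + 1) = a * (((ω (j + 1) : ℕ) : ℝ) * a ^ j) :=
    fun j => by ring
  simp_rw [this, tsum_mul_left]
  ring

lemma cantorSum_mem_Icc (ha : 0 < a) (ha' : a < 1 / 2) (ω : ℕ → Fin 2) :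
    cantorSum a ω ∈ Set.Icc (0 : ℝ) 1 := by
  unfold cantorSum
  have h1 : (0 : ℝ) < 1 - a := by linarith
  refine ⟨mul_nonneg h1.le (tsum_nonneg fun j => by positivity), ?_⟩
  have : ∑' j : ℕ, ((ω j : ℕ) : ℝ) * a ^ j ≤ ∑' j : ℕ, a ^ j := by
    refine (summable_digits ha ha' ω).tsum_le_tsum (fun j => ?_)
      (summable_geometric_of_lt_one ha.le (by linarith))
    have : ((ω j : ℕ) : ℝ) ≤ 1 := by exact_mod_cast Nat.lt_succ_iff.1 (ω j).2
    exact mul_le_of_le_one_left (by positivity) this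
  rw [tsum_geometric_of_lt_one ha.le (by linarith)] at this
  calc _ ≤ (1 - a) * (1 - a)⁻¹ := by gcongr
    _ = 1 := mul_inv_cancel₀ h1.ne'

lemma continuous_cantorSum (ha : 0 < a) (ha' : a < 1 / 2) : Continuous (cantorSum a) := by
  refine continuous_const.mul (continuous_tsum (u := fun j => a ^ j) (fun j => ?_)
    (summable_geometric_of_lt_one ha.le (by linarith)) fun j ω => ?_)
  · have : Continuous fun d : Fin 2 => ((d : ℕ) : ℝ) := continuous_of_discreteTopology
    exact (this.comp (continuous_apply j)).mul continuous_const
  · have : ((ω j : ℕ) : ℝ) ≤ 1 := by exact_mod_cast Nat.lt_succ_iff.1 (ω j).2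
    rw [Real.norm_of_nonneg (by positivity)]
    exact mul_le_of_le_one_left (by positivity) this

lemma measurable_cantorSum (ha : 0 < a) (ha' : a < 1 / 2) : Measurable (cantorSum a) :=
  (continuous_cantorSum ha ha').measurable

lemma isProbabilityMeasure_cantorMeasure (ha : 0 < a) (ha' : a < 1 / 2) :
    IsProbabilityMeasure (cantorMeasure a) :=
  Measure.isProbabilityMeasure_map (measurable_cantorSum ha ha').aemeasurable

lemma isCompact_centralCantorSet (ha : 0 < a) (ha' : a < 1 / 2) :
    IsCompact (centralCantorSet a) :=
  isCompact_range (continuous_cantorSum ha ha')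

lemma centralCantorSet_subset_Icc (ha : 0 < a) (ha' : a < 1 / 2) :
    centralCantorSet a ⊆ Set.Icc 0 1 := by
  rintro _ ⟨ω, rfl⟩
  exact cantorSum_mem_Icc ha ha' ω

lemma ae_mem_centralCantorSet (ha : 0 < a) (ha' : a < 1 / 2) :
    ∀ᵐ x ∂cantorMeasure a, x ∈ centralCantorSet a := by
  refine (ae_map_iff (measurable_cantorSum ha ha').aemeasurable
    (isCompact_centralCantorSet ha ha').isClosed.measurableSet).2 ?_
  exact ae_of_all _ fun ω => ⟨ω, rfl⟩

/-- The law of the first summand `(1 - a) ω_0`. -/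
noncomputable def firstDigitLaw (a : ℝ) : Measure ℝ :=
  ((PMF.uniformOfFintype (Fin 2)).toMeasure).map fun d : Fin 2 => (1 - a) * ((d : ℕ) : ℝ)

instance (a : ℝ) : IsProbabilityMeasure (firstDigitLaw a) :=
  Measure.isProbabilityMeasure_map Measurable.of_discrete.aemeasurable

lemma lintegral_firstDigitLaw (a : ℝ) {f : ℝ → ℝ≥0∞} (hf : Measurable f) :
    ∫⁻ x, f x ∂firstDigitLaw a = 2⁻¹ * f 0 + 2⁻¹ * f (1 - a) := by
  unfold firstDigitLaw
  rw [lintegral_map hf Measurable.of_discrete, lintegral_fintype]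
  simp [Fin.sum_univ_two, mul_comm]

lemma cantorMeasure_eq_conv (ha : 0 < a) (ha' : a < 1 / 2) :
    cantorMeasure a = firstDigitLaw a ∗ (cantorMeasure a).map fun x => a * x := by
  have hc := measurable_cantorSum ha ha'
  have := isProbabilityMeasure_cantorMeasure ha ha'
  unfold cantorMeasure firstDigitLaw
  rw [Measure.map_map (by fun_prop) hc, Measure.conv, Measure.map_prod_map _ _
    Measurable.of_discrete (by fun_prop), Measure.map_map (by fun_prop) (by fun_prop)]
  conv_lhs => rw [fairDigits_eq_map_consDigit, Measure.map_map hc measurable_consDigit]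
  congr 1
  ext p
  simp only [Function.comp_apply, Prod.map_fst, Prod.map_snd]
  rw [cantorSum_eq ha ha']
  rfl

lemma map_mul_conv (μ ν : Measure ℝ) [SFinite μ] [SFinite ν] (t : ℝ) :
    (μ ∗ ν).map (fun x => t * x) = (μ.map fun x => t * x) ∗ (ν.map fun x => t * x) :=
  Measure.map_conv_addMonoidHom (L := AddMonoidHom.mulLeft t) (measurable_const_mul t)

lemma map_mul_map_mul (μ : Measure ℝ) (s t : ℝ) :
    (μ.map fun x => s * x).map (fun x => t * x) = μ.map fun x => t * s * x := by
  rw [Measure.map_map (by fun_prop) (by fun_prop)]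
  congr 1
  ext x
  simp [mul_assoc]

instance (μ : Measure ℝ) [IsProbabilityMeasure μ] (t : ℝ) :
    IsProbabilityMeasure (μ.map fun x => t * x) :=
  Measure.isProbabilityMeasure_map (by fun_prop)

/-- The law of the first `n` summands: the `n`-th iterate of the self-similarity. -/
lemma exists_cantorMeasure_eq_conv_pow (ha : 0 < a) (ha' : a < 1 / 2) (n : ℕ) :
    ∃ κ : Measure ℝ, IsProbabilityMeasure κ ∧
      cantorMeasure a = κ ∗ (cantorMeasure a).map fun x => a ^ n * x := by
  have := isProbabilityMeasure_cantorMeasure ha ha'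
  induction n with
  | zero => exact ⟨Measure.dirac 0, inferInstance, by simp⟩
  | succ n ih =>
    obtain ⟨κ, hκ, h⟩ := ih
    refine ⟨κ ∗ (firstDigitLaw a).map fun x => a ^ n * x, inferInstance, ?_⟩
    rw [Measure.conv_assoc, pow_succ, ← map_mul_map_mul, ← map_mul_conv,
      ← cantorMeasure_eq_conv ha ha', ← h]

lemma cantorMeasure_apply (ha : 0 < a) (ha' : a < 1 / 2) (x r : ℝ) :
    cantorMeasure a (Metric.closedBall x r)
      = 2⁻¹ * cantorMeasure a (Metric.closedBall (x / a) (r / a))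
        + 2⁻¹ * cantorMeasure a (Metric.closedBall ((x - (1 - a)) / a) (r / a)) := by
  have := isProbabilityMeasure_cantorMeasure ha ha'
  have hball : ∀ z : ℝ, (fun y : ℝ => z + a * y) ⁻¹' Metric.closedBall x r
      = Metric.closedBall ((x - z) / a) (r / a) := fun z => by
    ext y
    simp only [Set.mem_preimage, Metric.mem_closedBall, Real.dist_eq]
    rw [le_div_iff₀ ha, ← abs_of_pos ha, ← abs_mul, abs_of_pos ha]
    congr! 2
    field_simp
    ring
  have hm : Measurable fun y : ℝ => (Metric.closedBall x r).indicator (1 : ℝ → ℝ≥0∞) y :=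
    measurable_one.indicator Metric.isClosed_closedBall.measurableSet
  conv_lhs => rw [cantorMeasure_eq_conv ha ha', ← lintegral_indicator_one
    Metric.isClosed_closedBall.measurableSet]
  have key : ∀ z : ℝ, ∫⁻ y, (Metric.closedBall x r).indicator (1 : ℝ → ℝ≥0∞) (z + y)
      ∂((cantorMeasure a).map fun x => a * x)
      = cantorMeasure a (Metric.closedBall ((x - z) / a) (r / a)) := fun z => by
    rw [lintegral_map (by exact hm.comp (measurable_const.add measurable_id')) (by fun_prop),
      ← hball z, ← lintegral_indicator_one]
    · rfl
    · exact (by fun_prop : Measurable fun y : ℝ => z + a * y)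
        Metric.isClosed_closedBall.measurableSet
  rw [Measure.lintegral_conv hm]
  simp_rw [key]
  rw [lintegral_firstDigitLaw _
    (measurable_measure_closedBall_comp _ (by fun_prop : Measurable fun z : ℝ => (x - z) / a) _)]
  simp

/-- The similarity dimension `log 2 / log (1 / a)` of the central Cantor set. -/
noncomputable def cantorDim (a : ℝ) : ℝ := Real.log 2 / -Real.log a

lemma cantorDim_pos (ha : 0 < a) (ha' : a < 1 / 2) : 0 < cantorDim a :=
  div_pos (Real.log_pos one_lt_two) (neg_pos.2 (Real.log_neg ha (by linarith)))

lemma rpow_cantorDim (ha : 0 < a) (ha' : a < 1 / 2) : a ^ cantorDim a = 2⁻¹ := by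
  have := (Real.log_neg ha (by linarith)).ne
  rw [Real.rpow_def_of_pos ha, cantorDim, ← mul_div_assoc, div_neg, mul_comm,
    mul_div_cancel_right₀ _ this, Real.exp_neg, Real.exp_log two_pos]

lemma pow_rpow_cantorDim (ha : 0 < a) (ha' : a < 1 / 2) (n : ℕ) :
    (a ^ n) ^ cantorDim a = 2⁻¹ ^ n := by
  rw [← rpow_cantorDim ha ha', ← Real.rpow_natCast, ← Real.rpow_natCast, ← Real.rpow_mul ha.le,
    ← Real.rpow_mul ha.le, mul_comm]

lemma cantorMeasure_closedBall_eq_zero (ha : 0 < a) (ha' : a < 1 / 2) {x r : ℝ}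
    (h : x + r < 0 ∨ 1 < x - r) : cantorMeasure a (Metric.closedBall x r) = 0 := by
  refine measure_mono_null (fun y hy => ?_) (ae_mem_centralCantorSet ha ha')
  intro hy'
  have := centralCantorSet_subset_Icc ha ha' hy'
  rw [Metric.mem_closedBall, Real.dist_eq, abs_le] at hy
  rcases h with h | h <;> linarith [this.1, this.2]

/-- The gap between the first-level pieces in `[0, a]` and `[1 - a, 1]` has length `1 - 2a`, so such
a ball meets only one of them. Hence one term of the self-similar identity vanishes and each level
contributes a factor `1/2`. -/
lemma cantorMeasure_closedBall_le_pow (ha : 0 < a) (ha' : a < 1 / 2) (n : ℕ) (x r : ℝ)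
    (h : 2 * r < (1 - 2 * a) * a ^ n) :
    cantorMeasure a (Metric.closedBall x r) ≤ 2⁻¹ ^ n := by
  have := isProbabilityMeasure_cantorMeasure ha ha'
  induction n generalizing x r with
  | zero => simpa using prob_le_one
  | succ n ih =>
    have hra : 2 * (r / a) < (1 - 2 * a) * a ^ n := by
      rw [← mul_div_assoc, div_lt_iff₀ ha]
      calc _ < _ := h
        _ = _ := by ring
    have hr1 : 2 * r < 1 - 2 * a :=
      h.trans_le (mul_le_of_le_one_right (by linarith) (pow_le_one₀ ha.le (by linarith)))
    rw [cantorMeasure_apply ha ha', pow_succ']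
    rcases le_or_gt (x - r) a with hx | hx
    · rw [cantorMeasure_closedBall_eq_zero ha ha' (x := (x - (1 - a)) / a), mul_zero, add_zero]
      · gcongr
        exact ih _ _ hra
      · left
        rw [← add_div]
        exact div_neg_of_neg_of_pos (by linarith) ha
    · rw [cantorMeasure_closedBall_eq_zero ha ha' (x := x / a), mul_zero, zero_add]
      · gcongr
        exact ih _ _ hra
      · right
        rw [← sub_div, lt_div_iff₀ ha]
        linarith

/-- The Cantor measure is Frostman regular of exponent `cantorDim a`. -/
lemma exists_cantorMeasure_closedBall_le (ha : 0 < a) (ha' : a < 1 / 2) :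
    ∃ K : ℝ, 0 < K ∧ ∀ x r : ℝ, 0 < r →
      cantorMeasure a (Metric.closedBall x r) ≤ ENNReal.ofReal (K * r ^ cantorDim a) := by
  have := isProbabilityMeasure_cantorMeasure ha ha'
  have hg : 0 < 1 - 2 * a := by linarith
  set d := cantorDim a
  have hd : 0 < d := cantorDim_pos ha ha'
  -- With this `c`, the bound `c r ≤ a^n` makes the diameter `2r` at most half of the gap `(1 - 2a)
  -- a^n`, hence strictly smaller. The factor 2 in the constant below pays for rounding `c r` to a
  -- power of `a`.
  set c : ℝ := 4 / (1 - 2 * a) with hc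
  have hcpos : 0 < c := by positivity
  refine ⟨2 * c ^ d, by positivity, fun x r hr => ?_⟩
  rcases le_or_gt 1 (c * r) with h1 | h1
  · refine prob_le_one.trans ?_
    rw [← ENNReal.ofReal_one]
    apply ENNReal.ofReal_le_ofReal
    rw [mul_assoc, ← Real.mul_rpow hcpos.le hr.le]
    linarith [Real.one_le_rpow h1 hd.le]
  · obtain ⟨n, hn1, hn2⟩ := exists_nat_pow_near_of_lt_one (mul_pos hcpos hr) h1.le ha
      (by linarith : a < 1)
    have h2 : 2 * r < (1 - 2 * a) * a ^ n := by
      have : r = c * r * (1 - 2 * a) / 4 := by rw [hc]; field_simp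
      have h3 : 0 < a ^ n := by positivity
      nlinarith
    refine (cantorMeasure_closedBall_le_pow ha ha' n x r h2).trans ?_
    have h3 : (2⁻¹ : ℝ) ^ n ≤ 2 * c ^ d * r ^ d := by
      rw [mul_assoc, ← Real.mul_rpow hcpos.le hr.le]
      have h4 := Real.rpow_le_rpow (by positivity) hn1.le hd.le
      rw [pow_rpow_cantorDim ha ha', pow_succ] at h4
      linarith
    refine le_trans (le_of_eq ?_) (ENNReal.ofReal_le_ofReal h3)
    rw [ENNReal.ofReal_pow (by norm_num), ENNReal.ofReal_inv_of_pos two_pos, ENNReal.ofReal_ofNat]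

lemma exists_correlationIntegral_cantorMeasure_le (ha : 0 < a) (ha' : a < 1 / 2) :
    ∃ K : ℝ, 0 < K ∧ ∀ r : ℝ, 0 < r →
      correlationIntegral (cantorMeasure a) r ≤ ENNReal.ofReal (K * r ^ cantorDim a) := by
  have := isProbabilityMeasure_cantorMeasure ha ha'
  obtain ⟨K, hK, h⟩ := exists_cantorMeasure_closedBall_le ha ha'
  exact ⟨K, hK, fun r hr => (lintegral_mono fun x => h x r hr).trans (by simp)⟩

end CantorMeasure

/-! ### Dimension bounds from ball masses, correlation integrals and coverings. -/

section Dimension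

/-- Mass distribution principle. -/
lemma ofReal_le_dimH_of_measure_closedBall_le {ν : Measure ℝ} {A : Set ℝ} {s M r₀ : ℝ}
    (hs : 0 < s) (hM : 0 < M) (hr₀ : 0 < r₀) (hA : ν A ≠ 0)
    (h : ∀ x ∈ A, ∀ r : ℝ, 0 < r → r ≤ r₀ →
      ν (Metric.closedBall x r) ≤ ENNReal.ofReal (M * r ^ s)) :
    ENNReal.ofReal s ≤ dimH A := by
  -- Radius `0` is included because sets of zero diameter occur in the comparison with Hausdorff
  -- measure.
  have h0 : ∀ x ∈ A, ∀ r : ℝ, 0 ≤ r → r ≤ r₀ →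
      ν (Metric.closedBall x r) ≤ ENNReal.ofReal (M * r ^ s) := by
    intro x hx r hr hr'
    rcases hr.eq_or_lt with rfl | hr
    · have hlim : Tendsto (fun r : ℝ => ENNReal.ofReal (M * r ^ s)) (𝓝[>] 0)
          (𝓝 (ENNReal.ofReal (M * 0 ^ s))) := by
        refine (ENNReal.tendsto_ofReal ?_)
        exact (((Real.continuousAt_rpow_const 0 s (.inr hs.le)).tendsto).mono_left
          nhdsWithin_le_nhds).const_mul M
      refine ge_of_tendsto hlim ?_
      filter_upwards [Ioc_mem_nhdsGT hr₀] with r hr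
      exact (measure_mono (Metric.closedBall_subset_closedBall hr.1.le)).trans (h x hx r hr.1 hr.2)
    · exact h x hx r hr hr'
  have key : (ENNReal.ofReal M)⁻¹ • ν.restrict A ≤ μH[s] := by
    refine Measure.le_hausdorffMeasure s _ (ENNReal.ofReal r₀) (by simpa using hr₀) fun U hU => ?_
    rw [Measure.smul_apply, smul_eq_mul]
    have hfin : Metric.ediam U ≠ ⊤ := ne_top_of_le_ne_top ENNReal.ofReal_ne_top hU
    have hdiam : Metric.ediam (closure U) = ENNReal.ofReal (Metric.diam U) := by
      rw [Metric.ediam_closure, Metric.diam, ENNReal.ofReal_toReal hfin]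
    have hU' : Metric.diam U ≤ r₀ := by
      rw [Metric.diam]
      exact ENNReal.toReal_le_of_le_ofReal hr₀.le hU
    have hle : ν.restrict A U ≤ ENNReal.ofReal (M * Metric.diam U ^ s) := by
      refine (measure_mono subset_closure).trans ?_
      rw [Measure.restrict_apply isClosed_closure.measurableSet]
      rcases (closure U ∩ A).eq_empty_or_nonempty with he | ⟨x, hxU, hxA⟩
      · simp [he]
      · refine (measure_mono (t := Metric.closedBall x (Metric.diam U)) ?_).trans
          (h0 x hxA _ Metric.diam_nonneg hU')
        intro y hy
        rw [Metric.mem_closedBall, ← ENNReal.ofReal_le_ofReal_iff Metric.diam_nonneg,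
          ← edist_dist, ← hdiam]
        exact Metric.edist_le_ediam_of_mem hy.1 hxU
    calc _ ≤ (ENNReal.ofReal M)⁻¹ * ENNReal.ofReal (M * Metric.diam U ^ s) := by gcongr
      _ = Metric.ediam U ^ s := by
        rw [ENNReal.ofReal_mul hM.le, ← mul_assoc, ENNReal.inv_mul_cancel (by simpa using hM)
          ENNReal.ofReal_ne_top, one_mul, ← ENNReal.ofReal_rpow_of_nonneg Metric.diam_nonneg hs.le,
          Metric.diam, ENNReal.ofReal_toReal hfin]
  have hpos : μH[s] A ≠ 0 := by
    intro h0
    have := key A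
    rw [h0, Measure.smul_apply, Measure.restrict_apply_self, smul_eq_mul, nonpos_iff_eq_zero,
      mul_eq_zero] at this
    exact this.elim (by simp) hA
  have := le_dimH_of_hausdorffMeasure_ne_zero (d := s.toNNReal) (s := A)
    (by rwa [Real.coe_toNNReal s hs.le])
  exact this

/-- A power bound on the correlation integral bounds the Hausdorff dimension from below. -/
lemma ofReal_le_dimH_of_correlationIntegral_le {ν : Measure ℝ} [IsProbabilityMeasure ν]
    {s s' K r₀ : ℝ} (hs' : 0 < s') (hss : s' < s) (hr₀ : 0 < r₀)
    (h : ∀ r : ℝ, 0 < r → r ≤ r₀ → correlationIntegral ν r ≤ ENNReal.ofReal (K * r ^ s))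
    {E : Set ℝ} (hE : ν Eᶜ = 0) : ENNReal.ofReal s' ≤ dimH E := by
  obtain ⟨k₀, hk₀⟩ := exists_pow_lt_of_lt_one hr₀ (by norm_num : (1 / 2 : ℝ) < 1)
  set ρ : ℕ → ℝ := fun k => (1 / 2) ^ (k + k₀)
  have hρpos : ∀ k, 0 < ρ k := fun k => by positivity
  have hρle : ∀ k, ρ k ≤ r₀ := fun k =>
    (pow_le_pow_of_le_one (by norm_num) (by norm_num) (Nat.le_add_left k₀ k)).trans hk₀.le
  have hmeas : ∀ k, Measurable fun x =>
      ENNReal.ofReal ((ρ k) ^ (-s')) * ν (Metric.closedBall x (ρ k)) := fun k =>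
    (measurable_measure_closedBall ν (ρ k)).const_mul _
  -- A dyadic form of the `s'`-energy: its `k`-th term is at most a constant times `ρ k ^ (s - s')`,
  -- so the series is geometric.
  have hfin : ∫⁻ x, ∑' k, ENNReal.ofReal ((ρ k) ^ (-s')) * ν (Metric.closedBall x (ρ k)) ∂ν
      ≠ ⊤ := by
    rw [lintegral_tsum fun k => (hmeas k).aemeasurable]
    have hle : ∀ k, ∫⁻ x, ENNReal.ofReal ((ρ k) ^ (-s')) * ν (Metric.closedBall x (ρ k)) ∂ν
        ≤ ENNReal.ofReal (|K| * ((1 / 2 : ℝ) ^ (s - s')) ^ (k + k₀)) := by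
      intro k
      rw [lintegral_const_mul _ (measurable_measure_closedBall ν (ρ k))]
      refine (mul_le_mul_right (h (ρ k) (hρpos k) (hρle k)) _).trans ?_
      rw [← ENNReal.ofReal_mul (by have := hρpos k; positivity)]
      apply ENNReal.ofReal_le_ofReal
      have e1 : ((1 / 2 : ℝ) ^ (s - s')) ^ (k + k₀) = ρ k ^ (s - s') := by
        change _ = ((1 / 2 : ℝ) ^ (k + k₀)) ^ (s - s')
        rw [← Real.rpow_natCast, ← Real.rpow_natCast, ← Real.rpow_mul (by norm_num),
          ← Real.rpow_mul (by norm_num), mul_comm]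
      have e2 : ρ k ^ (s - s') = ρ k ^ (-s') * ρ k ^ s := by
        rw [← Real.rpow_add (hρpos k)]
        congr 1; ring
      rw [e1, e2]
      have h1 : 0 ≤ ρ k ^ (-s') * ρ k ^ s := by have := hρpos k; positivity
      calc _ = K * (ρ k ^ (-s') * ρ k ^ s) := by ring
        _ ≤ _ := by gcongr; exact le_abs_self K
    refine ne_top_of_le_ne_top ?_ (ENNReal.tsum_le_tsum hle)
    have hsum : Summable fun k : ℕ => |K| * ((1 / 2 : ℝ) ^ (s - s')) ^ (k + k₀) := by
      have hq : ((1 / 2 : ℝ) ^ (s - s')) < 1 :=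
        Real.rpow_lt_one (by norm_num) (by norm_num) (by linarith)
      have := (summable_nat_add_iff k₀).2 (summable_geometric_of_lt_one (by positivity) hq)
      exact this.mul_left _
    exact hsum.tsum_ofReal_ne_top
  have hae := ae_lt_top (Measurable.tsum hmeas) hfin
  -- Almost every point has a finite sum, hence lies in some `F M`; one of these meets `E` in
  -- positive measure, and there the mass distribution principle applies.
  let F : ℕ → Set ℝ := fun M => {x | ∀ k, ENNReal.ofReal ((ρ k) ^ (-s'))
    * ν (Metric.closedBall x (ρ k)) ≤ M}
  have hcov : ∀ᵐ x ∂ν, x ∈ ⋃ M, E ∩ F M := by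
    have hE' : ∀ᵐ x ∂ν, x ∈ E := hE
    filter_upwards [hae, hE'] with x hx hxE
    obtain ⟨M, hM⟩ := ENNReal.exists_nat_gt hx.ne
    exact Set.mem_iUnion.2 ⟨M, hxE, fun k => (ENNReal.le_tsum k).trans hM.le⟩
  obtain ⟨M, hM⟩ : ∃ M, ν (E ∩ F M) ≠ 0 := by
    by_contra! hcon
    have h1 : ν (⋃ M, E ∩ F M) = 0 := measure_iUnion_null hcon
    have h2 : ∀ᵐ x ∂ν, x ∉ ⋃ M, E ∩ F M := measure_eq_zero_iff_ae_notMem.1 h1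
    obtain ⟨x, hx, hx'⟩ := (hcov.and h2).exists
    exact hx' hx
  -- The factor `2 ^ s'` comes from rounding a radius up to a power of `1/2`; `M + 1` keeps the
  -- constant positive when `M = 0`.
  refine le_trans (ofReal_le_dimH_of_measure_closedBall_le (M := (M + 1) * 2 ^ s')
    (r₀ := ρ 0) hs' (by positivity) (hρpos 0) hM ?_) (dimH_mono Set.inter_subset_left)
  intro x hx r hr hr'
  obtain ⟨n, hn1, hn2⟩ := exists_nat_pow_near_of_lt_one hr
    (hr'.trans (pow_le_one₀ (by norm_num) (by norm_num))) (by norm_num : (0 : ℝ) < 1 / 2)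
    (by norm_num)
  have hkn : k₀ ≤ n := by
    by_contra! hlt
    have : ρ 0 ≤ (1 / 2) ^ (n + 1) := pow_le_pow_of_le_one (by norm_num) (by norm_num) (by omega)
    linarith
  obtain ⟨k, rfl⟩ := Nat.exists_eq_add_of_le' hkn
  have h1 := hx.2 k
  refine (measure_mono (Metric.closedBall_subset_closedBall hn2)).trans ?_
  have h2 : ν (Metric.closedBall x (ρ k)) ≤ ENNReal.ofReal (ρ k ^ s' * M) := by
    have hne : ENNReal.ofReal (ρ k ^ (-s')) ≠ 0 := by
      simpa using Real.rpow_pos_of_pos (hρpos k) (-s')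
    rw [← ENNReal.mul_le_mul_iff_right hne ENNReal.ofReal_ne_top]
    refine h1.trans (le_of_eq ?_)
    rw [← ENNReal.ofReal_mul (Real.rpow_nonneg (hρpos k).le _), ← mul_assoc,
      ← Real.rpow_add (hρpos k), neg_add_cancel, Real.rpow_zero, one_mul, ENNReal.ofReal_natCast]
  refine h2.trans (ENNReal.ofReal_le_ofReal ?_)
  have h3 : ρ k ^ s' ≤ 2 ^ s' * r ^ s' := by
    rw [← Real.mul_rpow (by norm_num) hr.le]
    refine Real.rpow_le_rpow (hρpos k).le ?_ hs'.le
    rw [pow_succ] at hn1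
    change (1 / 2) ^ (k + k₀) ≤ 2 * r
    linarith
  have h4 : (0 : ℝ) ≤ 2 ^ s' * r ^ s' := by positivity
  calc ρ k ^ s' * M ≤ (2 ^ s' * r ^ s') * (M + 1) := by gcongr; linarith
    _ = _ := by ring

/-- For admissible `s`, optimal covers eventually satisfy `N(A, ε) ε^s ≤ 1`. Their pieces have
diameter at most `2ε`, so the `s`-dimensional Hausdorff measure is at most `2^s`. -/
lemma dimH_le_upperMinkowskiDim (A : Set ℝ) : dimH A ≤ upperMinkowskiDim A := by
  refine le_iInf₂ fun s hs => dimH_le_of_hausdorffMeasure_ne_top ?_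
  have hev : ∀ᶠ ε : ℝ≥0 in 𝓝[>] 0, ∃ T : Finset ℝ, A ⊆ ⋃ t ∈ T, Metric.closedBall t ε ∧
      (T.card : ℝ≥0∞) * (ε : ℝ≥0∞) ^ (s : ℝ) ≤ 1 := by
    filter_upwards [hs.eventually_lt_const one_pos, self_mem_nhdsWithin] with ε hε hε0
    have hne : Metric.externalCoveringNumber ε A ≠ ⊤ := by
      intro htop
      rw [htop] at hε
      have : ((ε : ℝ≥0∞) ^ (s : ℝ)) ≠ 0 := by
        rw [Ne, ENNReal.rpow_eq_zero_iff]
        simp [(show (0 : ℝ≥0) < ε from hε0).ne']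
      simp [ENNReal.top_mul this] at hε
    have hlt : Metric.externalCoveringNumber ε A < Metric.externalCoveringNumber ε A + 1 :=
      (ENat.lt_add_one_iff hne).2 le_rfl
    conv_lhs at hlt => rw [Metric.externalCoveringNumber]
    simp only [iInf_lt_iff] at hlt
    obtain ⟨C, hC, hlt⟩ := hlt
    rw [ENat.lt_add_one_iff hne] at hlt
    have hCfin : C.Finite := Set.encard_ne_top_iff.1 (ne_top_of_le_ne_top hne hlt)
    refine ⟨hCfin.toFinset, ?_, ?_⟩
    · intro x hx
      obtain ⟨c, hc, hxc⟩ := hC hx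
      simp only [Set.Finite.mem_toFinset, Set.mem_iUnion]
      exact ⟨c, hc, by simpa [edist_dist, ENNReal.ofReal_le_iff_le_toReal] using hxc⟩
    · refine le_trans ?_ hε.le
      gcongr
      have : ((hCfin.toFinset.card : ℕ∞) : ℝ≥0∞) ≤ Metric.externalCoveringNumber ε A := by
        rw [← hCfin.encard_eq_coe_toFinset_card]
        exact_mod_cast hlt
      simpa using this
  classical
  choose! T hT hTc using fun (ε : ℝ≥0) (h : ∃ T : Finset ℝ, A ⊆ ⋃ t ∈ T, Metric.closedBall t ε ∧
      (T.card : ℝ≥0∞) * (ε : ℝ≥0∞) ^ (s : ℝ) ≤ 1) => h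
  have hlim : Tendsto (fun ε : ℝ≥0 => 2 * (ε : ℝ≥0∞)) (𝓝[>] 0) (𝓝 0) := by
    have : Tendsto (fun ε : ℝ≥0 => ((2 * ε : ℝ≥0) : ℝ≥0∞)) (𝓝[>] 0) (𝓝 ((2 * 0 : ℝ≥0) : ℝ≥0∞)) :=
      (ENNReal.continuous_coe.comp (continuous_const.mul continuous_id)).tendsto' 0 _ rfl
        |>.mono_left nhdsWithin_le_nhds
    simpa using this
  have hbound := Measure.hausdorffMeasure_le_liminf_sum (s : ℝ) A (l := 𝓝[>] (0 : ℝ≥0))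
    (ι := fun ε => {x // x ∈ T ε}) (fun ε : ℝ≥0 => 2 * (ε : ℝ≥0∞)) hlim
    (fun ε t => Metric.closedBall (t : ℝ) ε)
    (Eventually.of_forall fun ε t => by
      simpa [Metric.closedEBall_coe] using Metric.ediam_closedEBall_le (x := (t : ℝ)) (r := (ε : ℝ≥0∞)))
    (hev.mono fun ε h x hx => by
      obtain ⟨t, ht, hxt⟩ := Set.mem_iUnion₂.1 (hT ε h hx)
      exact Set.mem_iUnion.2 ⟨⟨t, ht⟩, hxt⟩)
  refine ne_top_of_le_ne_top (b := (2 : ℝ≥0∞) ^ (s : ℝ)) (by simp) (hbound.trans ?_)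
  refine (liminf_le_liminf (hev.mono fun ε h => ?_)).trans (liminf_const (f := 𝓝[>] (0 : ℝ≥0)) _).le
  calc ∑ i : {x // x ∈ T ε}, Metric.ediam (Metric.closedBall (i : ℝ) ε) ^ (s : ℝ)
      ≤ ∑ i : {x // x ∈ T ε}, (2 * (ε : ℝ≥0∞)) ^ (s : ℝ) := by
        gcongr with t
        simpa [Metric.closedEBall_coe] using Metric.ediam_closedEBall_le (x := (t : ℝ)) (r := (ε : ℝ≥0∞))
    _ = 2 ^ (s : ℝ) * ((T ε).card * (ε : ℝ≥0∞) ^ (s : ℝ)) := by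
        rw [Finset.sum_const, ENNReal.mul_rpow_of_nonneg _ _ (NNReal.coe_nonneg s)]
        simp
        ring
    _ ≤ 2 ^ (s : ℝ) * 1 := by gcongr; exact hTc ε h
    _ = _ := mul_one _

lemma dimH_le_packingDim (A : Set ℝ) : dimH A ≤ packingDim A := by
  refine le_iInf₂ fun F _ => le_iInf fun hA => ?_
  refine (dimH_mono hA).trans ?_
  rw [dimH_iUnion]
  exact iSup_mono fun i => dimH_le_upperMinkowskiDim (F i)

lemma packingDim_le_upperMinkowskiDim {A : Set ℝ} (hA : Bornology.IsBounded A) :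
    packingDim A ≤ upperMinkowskiDim A :=
  (iInf₂_le (fun _ => A) fun _ => hA).trans
    ((iInf_le _ (Set.subset_iUnion (fun _ : ℕ => A) 0)).trans (by simp))

/-- The set `A` is covered by `O(ε^{-d})` closed intervals of radius `ε`. -/
def HasBoxBound (A : Set ℝ) (d : ℝ) : Prop :=
  ∃ K : ℝ, 0 < K ∧ ∀ ε : ℝ, 0 < ε → ε ≤ 1 → ∃ T : Finset ℝ, (T.card : ℝ) ≤ K * ε ^ (-d) ∧
    A ⊆ ⋃ t ∈ T, Metric.closedBall t ε

/-- At each level the two contractions double a cover while multiplying its radius by `a`, and `2^n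
= (a^n)^{-d}` for the similarity dimension `d`. -/
lemma hasBoxBound_centralCantorSet {a : ℝ} (ha : 0 < a) (ha' : a < 1 / 2) :
    HasBoxBound (centralCantorSet a) (cantorDim a) := by
  classical
  have hcov : ∀ n : ℕ, ∃ T : Finset ℝ, T.card ≤ 2 ^ n ∧
      centralCantorSet a ⊆ ⋃ t ∈ T, Metric.closedBall t (a ^ n) := by
    intro n
    induction n with
    | zero =>
      refine ⟨{0}, by simp, fun x hx => ?_⟩
      have := centralCantorSet_subset_Icc ha ha' hx
      simpa [Real.dist_eq, abs_le] using ⟨by linarith [this.1], this.2⟩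
    | succ n ih =>
      obtain ⟨T, hT, hc⟩ := ih
      refine ⟨T.image (fun t => a * t) ∪ T.image (fun t => (1 - a) + a * t), ?_, ?_⟩
      · refine (Finset.card_union_le _ _).trans ?_
        rw [pow_succ, mul_two]
        exact add_le_add (Finset.card_image_le.trans hT) (Finset.card_image_le.trans hT)
      · rintro _ ⟨ω, rfl⟩
        obtain ⟨t, ht, hxt⟩ := Set.mem_iUnion₂.1 (hc ⟨fun n => ω (n + 1), rfl⟩)
        rw [Metric.mem_closedBall, Real.dist_eq] at hxt
        have hd : ∀ z : ℝ, dist (z + a * cantorSum a fun n => ω (n + 1)) (z + a * t)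
            ≤ a ^ (n + 1) := fun z => by
          rw [Real.dist_eq, add_sub_add_left_eq_sub, ← mul_sub, abs_mul, abs_of_pos ha, pow_succ']
          gcongr
        rw [cantorSum_eq ha ha']
        rcases (by decide : ∀ d : Fin 2, d = 0 ∨ d = 1) (ω 0) with h | h
        · refine Set.mem_iUnion₂.2 ⟨a * t, ?_, ?_⟩
          · exact Finset.mem_union_left _ (Finset.mem_image_of_mem _ ht)
          · simpa [h] using hd 0
        · refine Set.mem_iUnion₂.2 ⟨(1 - a) + a * t, ?_, ?_⟩
          · exact Finset.mem_union_right _ (Finset.mem_image_of_mem _ ht)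
          · rw [h]
            simpa using hd (1 - a)
  refine ⟨2, two_pos, fun ε hε hε1 => ?_⟩
  obtain ⟨n, hn1, hn2⟩ := exists_nat_pow_near_of_lt_one hε hε1 ha (by linarith : a < 1)
  obtain ⟨T, hT, hc⟩ := hcov (n + 1)
  refine ⟨T, ?_, hc.trans (Set.iUnion₂_mono fun t _ =>
    Metric.closedBall_subset_closedBall hn1.le)⟩
  have h1 := Real.rpow_le_rpow hε.le hn2 (cantorDim_pos ha ha').le
  rw [pow_rpow_cantorDim ha ha', inv_pow] at h1
  rw [Real.rpow_neg hε.le]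
  have h2 : (2 : ℝ) ^ n ≤ (ε ^ cantorDim a)⁻¹ := by
    rw [le_inv_comm₀ (by positivity) (by positivity)]
    exact h1
  calc (T.card : ℝ) ≤ 2 ^ (n + 1) := by exact_mod_cast hT
    _ = 2 * 2 ^ n := pow_succ' _ _
    _ ≤ _ := by gcongr

lemma hasBoxBound_one_of_isBounded {A : Set ℝ} (hA : Bornology.IsBounded A) :
    HasBoxBound A 1 := by
  classical
  obtain ⟨R, hR, hAR⟩ := hA.subset_closedBall_lt 0 0
  refine ⟨2 * R + 2, by positivity, fun ε hε hε1 => ?_⟩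
  refine ⟨(Finset.range (⌊2 * R / ε⌋₊ + 1)).image fun k : ℕ => -R + k * ε, ?_, ?_⟩
  · have h1 : (⌊2 * R / ε⌋₊ : ℝ) ≤ 2 * R / ε := Nat.floor_le (by positivity)
    have h2 : 1 ≤ ε⁻¹ := (one_le_inv₀ hε).2 hε1
    have h3 := Finset.card_image_le (s := Finset.range (⌊2 * R / ε⌋₊ + 1))
      (f := fun k : ℕ => -R + k * ε)
    rw [Finset.card_range] at h3
    rw [Real.rpow_neg_one]
    calc _ ≤ ((⌊2 * R / ε⌋₊ + 1 : ℕ) : ℝ) := by exact_mod_cast h3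
      _ ≤ 2 * R / ε + 1 := by push_cast; linarith
      _ ≤ 2 * R * ε⁻¹ + 2 * ε⁻¹ := by rw [div_eq_mul_inv]; linarith
      _ = _ := by ring
  · intro x hx
    have hx' := hAR hx
    rw [Metric.mem_closedBall, Real.dist_eq, sub_zero, abs_le] at hx'
    have h0 : 0 ≤ (x + R) / ε := div_nonneg (by linarith) hε.le
    refine Set.mem_iUnion₂.2 ⟨-R + ⌊(x + R) / ε⌋₊ * ε, Finset.mem_image_of_mem _ ?_, ?_⟩
    · rw [Finset.mem_range, Nat.lt_succ_iff]
      gcongr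
      linarith
    · have h1 := Nat.floor_le h0
      have h2 := (Nat.lt_floor_add_one ((x + R) / ε)).le
      rw [le_div_iff₀ hε] at h1
      rw [div_le_iff₀ hε] at h2
      rw [Metric.mem_closedBall, Real.dist_eq, abs_le]
      constructor <;> linarith

/-- Covers of both sets at radius `ε / (1 + |t|)` combine into a cover at radius `ε`, and the
numbers of balls multiply. -/
lemma HasBoxBound.image2_add_mul {A B : Set ℝ} {d e : ℝ} (hA : HasBoxBound A d)
    (hB : HasBoxBound B e) (t : ℝ) :
    HasBoxBound (Set.image2 (fun x y => x + t * y) A B) (d + e) := by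
  classical
  obtain ⟨K, hK, hA⟩ := hA
  obtain ⟨L, hL, hB⟩ := hB
  set c : ℝ := 1 + |t| with hc
  have hc1 : 1 ≤ c := by rw [hc]; linarith [abs_nonneg t]
  have hc0 : 0 < c := by linarith
  refine ⟨K * L * c ^ (d + e), by positivity, fun ε hε hε1 => ?_⟩
  have hε' : 0 < ε / c := by positivity
  have hε1' : ε / c ≤ 1 := (div_le_one hc0).2 (by linarith)
  obtain ⟨S, hS, hAS⟩ := hA _ hε' hε1'
  obtain ⟨T, hT, hBT⟩ := hB _ hε' hε1'
  refine ⟨Finset.image₂ (fun x y => x + t * y) S T, ?_, ?_⟩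
  · calc ((Finset.image₂ (fun x y => x + t * y) S T).card : ℝ) ≤ S.card * T.card := by
          exact_mod_cast Finset.card_image₂_le _ _ _
      _ ≤ (K * (ε / c) ^ (-d)) * (L * (ε / c) ^ (-e)) := by gcongr
      _ = K * L * (ε / c) ^ (-(d + e)) := by
          rw [neg_add, Real.rpow_add hε']; ring
      _ = _ := by
          rw [Real.div_rpow hε.le hc0.le, Real.rpow_neg hc0.le, div_inv_eq_mul]; ring
  · rintro _ ⟨x, hx, y, hy, rfl⟩
    obtain ⟨u, hu, hxu⟩ := Set.mem_iUnion₂.1 (hAS hx)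
    obtain ⟨v, hv, hyv⟩ := Set.mem_iUnion₂.1 (hBT hy)
    refine Set.mem_iUnion₂.2 ⟨u + t * v, Finset.mem_image₂_of_mem hu hv, ?_⟩
    rw [Metric.mem_closedBall, Real.dist_eq] at hxu hyv ⊢
    calc |x + t * y - (u + t * v)| = |(x - u) + t * (y - v)| := by congr 1; ring
      _ ≤ |x - u| + |t| * |y - v| := by rw [← abs_mul]; exact abs_add_le _ _
      _ ≤ ε / c + |t| * (ε / c) := by gcongr
      _ = ε := by rw [hc]; field_simp

lemma HasBoxBound.upperMinkowskiDim_le {A : Set ℝ} {d : ℝ} (hd : 0 ≤ d) (hA : HasBoxBound A d) :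
    upperMinkowskiDim A ≤ ENNReal.ofReal d := by
  obtain ⟨K, hK, hA⟩ := hA
  refine le_of_forall_gt_imp_ge_of_dense fun s hs => ?_
  rcases eq_or_ne s ⊤ with rfl | hs'
  · exact le_top
  lift s to ℝ≥0 using hs'
  have hds : d < s := by
    have := (ENNReal.ofReal_lt_iff_lt_toReal hd ENNReal.coe_ne_top).1 hs
    simpa using this
  refine iInf₂_le s ?_
  have hlim : Tendsto (fun ε : ℝ≥0 => ENNReal.ofReal (K * (ε : ℝ) ^ ((s : ℝ) - d))) (𝓝[>] 0)
      (𝓝 0) := by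
    have h1 : Tendsto (fun ε : ℝ≥0 => K * (ε : ℝ) ^ ((s : ℝ) - d)) (𝓝 0)
        (𝓝 (K * (0 : ℝ) ^ ((s : ℝ) - d))) :=
      ((NNReal.continuous_coe.tendsto' 0 _ rfl).rpow_const (.inr (by linarith))).const_mul K
    rw [Real.zero_rpow (by linarith), mul_zero] at h1
    simpa using ENNReal.tendsto_ofReal (h1.mono_left nhdsWithin_le_nhds)
  refine tendsto_of_tendsto_of_tendsto_of_le_of_le' tendsto_const_nhds hlim
    (Eventually.of_forall fun _ => zero_le) ?_
  filter_upwards [Ioc_mem_nhdsGT (zero_lt_one : (0 : ℝ≥0) < 1)] with ε hε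
  have hε0 : (0 : ℝ) < ε := by exact_mod_cast hε.1
  obtain ⟨T, hT, hcov⟩ := hA ε hε0 (by exact_mod_cast hε.2)
  have hc : Metric.IsCover ε A (T : Set ℝ) := fun x hx => by
    obtain ⟨t, ht, hxt⟩ := Set.mem_iUnion₂.1 (hcov hx)
    exact ⟨t, ht, by simpa [edist_dist, ENNReal.ofReal_le_iff_le_toReal] using hxt⟩
  have hle : ((Metric.externalCoveringNumber ε A : ℕ∞) : ℝ≥0∞) ≤ ENNReal.ofReal (K * ε ^ (-d)) := by
    calc ((Metric.externalCoveringNumber ε A : ℕ∞) : ℝ≥0∞) ≤ (((T : Set ℝ).encard : ℕ∞) : ℝ≥0∞) := by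
          exact_mod_cast hc.externalCoveringNumber_le_encard
      _ = (T.card : ℝ≥0∞) := by simp
      _ = ENNReal.ofReal (T.card : ℝ) := by simp
      _ ≤ _ := ENNReal.ofReal_le_ofReal hT
  calc _ ≤ ENNReal.ofReal (K * ε ^ (-d)) * (ε : ℝ≥0∞) ^ (s : ℝ) := by gcongr
    _ = _ := by
      rw [← ENNReal.ofReal_coe_nnreal, ENNReal.ofReal_rpow_of_pos hε0,
        ← ENNReal.ofReal_mul (by positivity), mul_assoc, ← Real.rpow_add hε0]
      congr 3; ring

/-- A box-counting bound on the support bounds the correlation integral from below. -/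
lemma HasBoxBound.exists_le_correlationIntegral {A : Set ℝ} {d : ℝ} (hA : HasBoxBound A d)
    {ν : Measure ℝ} [IsProbabilityMeasure ν] (hν : ∀ᵐ x ∂ν, x ∈ A) :
    ∃ c : ℝ, 0 < c ∧ ∀ r : ℝ, 0 < r → r ≤ 1 →
      ENNReal.ofReal (c * r ^ d) ≤ correlationIntegral ν r := by
  classical
  obtain ⟨K, hK, hA⟩ := hA
  refine ⟨1 / (4 * K * 2 ^ d), by positivity, fun r hr hr1 => ?_⟩
  obtain ⟨T, hT, hcov⟩ := hA (r / 2) (by positivity) (by linarith)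
  have hTne : T.Nonempty := by
    obtain ⟨x, hx⟩ := hν.exists
    obtain ⟨t, ht, -⟩ := Set.mem_iUnion₂.1 (hcov hx)
    exact ⟨t, ht⟩
  have hcard : 0 < (T.card : ℝ) := by exact_mod_cast hTne.card_pos
  -- Half the average mass of a covering ball: the balls lighter than `w` have total mass at most
  -- `1/2`. The heavy ones then carry at least `1/2`, and each of their points has at least `w`
  -- within distance `r`.
  set w : ℝ := 1 / (2 * T.card) with hw
  have hwpos : 0 < w := by positivity
  set G : Finset ℝ := T.filter fun t => ENNReal.ofReal w ≤ ν (Metric.closedBall t (r / 2))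
  have hG : ∀ x ∈ ⋃ t ∈ G, Metric.closedBall t (r / 2),
      ENNReal.ofReal w ≤ ν (Metric.closedBall x r) := by
    intro x hx
    obtain ⟨t, ht, hxt⟩ := Set.mem_iUnion₂.1 hx
    refine (Finset.mem_filter.1 ht).2.trans (measure_mono ?_)
    refine Metric.closedBall_subset_closedBall' ?_
    rw [Metric.mem_closedBall, dist_comm] at hxt
    linarith
  have hGm : MeasurableSet (⋃ t ∈ G, Metric.closedBall t (r / 2)) :=
    Finset.measurableSet_biUnion _ fun t _ => Metric.isClosed_closedBall.measurableSet
  have hbad : ν (⋃ t ∈ T.filter fun t => ¬ ENNReal.ofReal w ≤ ν (Metric.closedBall t (r / 2)),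
      Metric.closedBall t (r / 2)) ≤ ENNReal.ofReal (1 / 2) := by
    refine (measure_biUnion_finset_le _ _).trans ?_
    calc _ ≤ ∑ t ∈ T.filter (fun t => ¬ ENNReal.ofReal w ≤ ν (Metric.closedBall t (r / 2))),
          ENNReal.ofReal w := Finset.sum_le_sum fun t ht =>
            (not_le.1 (Finset.mem_filter.1 ht).2).le
      _ ≤ ∑ t ∈ T, ENNReal.ofReal w := Finset.sum_le_sum_of_subset (Finset.filter_subset _ _)
      _ = ENNReal.ofReal (1 / 2) := by
        rw [Finset.sum_const, nsmul_eq_mul, ← ENNReal.ofReal_natCast,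
          ← ENNReal.ofReal_mul hcard.le, hw]
        congr 1; field_simp
  have hgood : ENNReal.ofReal (1 / 2) ≤ ν (⋃ t ∈ G, Metric.closedBall t (r / 2)) := by
    have h1 : (1 : ℝ≥0∞) ≤ ν (⋃ t ∈ G, Metric.closedBall t (r / 2)) + ENNReal.ofReal (1 / 2) := by
      rw [← measure_univ (μ := ν)]
      refine le_trans ?_ (add_le_add_right hbad _)
      refine le_trans (measure_mono_ae ?_) (measure_union_le _ _)
      filter_upwards [hν] with x hx _
      obtain ⟨t, ht, hxt⟩ := Set.mem_iUnion₂.1 (hcov hx)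
      by_cases h : ENNReal.ofReal w ≤ ν (Metric.closedBall t (r / 2))
      · exact Or.inl (Set.mem_iUnion₂.2 ⟨t, Finset.mem_filter.2 ⟨ht, h⟩, hxt⟩)
      · exact Or.inr (Set.mem_iUnion₂.2 ⟨t, Finset.mem_filter.2 ⟨ht, h⟩, hxt⟩)
    have h2 : (1 : ℝ≥0∞) = ENNReal.ofReal (1 / 2) + ENNReal.ofReal (1 / 2) := by
      rw [← ENNReal.ofReal_add (by norm_num) (by norm_num)]; norm_num
    rw [h2] at h1
    exact (ENNReal.add_le_add_iff_right ENNReal.ofReal_ne_top).1 h1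
  calc ENNReal.ofReal (1 / (4 * K * 2 ^ d) * r ^ d) ≤ ENNReal.ofReal (w * (1 / 2)) := by
        apply ENNReal.ofReal_le_ofReal
        have h1 : K * (r / 2) ^ (-d) = K * 2 ^ d * (r ^ d)⁻¹ := by
          rw [Real.div_rpow hr.le two_pos.le, Real.rpow_neg hr.le, Real.rpow_neg two_pos.le,
            div_inv_eq_mul]
          ring
        rw [h1] at hT
        have h2 : 1 / (4 * K * 2 ^ d) * r ^ d = 1 / (4 * (K * 2 ^ d * (r ^ d)⁻¹)) := by
          have := Real.rpow_pos_of_pos hr d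
          field_simp
        rw [h2, hw]
        have h3 : 1 / (2 * (T.card : ℝ)) * (1 / 2) = 1 / (4 * T.card) := by
          field_simp; norm_num
        rw [h3]
        gcongr
    _ = ENNReal.ofReal w * ENNReal.ofReal (1 / 2) := ENNReal.ofReal_mul hwpos.le
    _ ≤ ENNReal.ofReal w * ν (⋃ t ∈ G, Metric.closedBall t (r / 2)) := by gcongr
    _ = ∫⁻ _ in ⋃ t ∈ G, Metric.closedBall t (r / 2), ENNReal.ofReal w ∂ν := by simp
    _ ≤ ∫⁻ x in ⋃ t ∈ G, Metric.closedBall t (r / 2), ν (Metric.closedBall x r) ∂ν :=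
        setLIntegral_mono' hGm hG
    _ ≤ correlationIntegral ν r := setLIntegral_le_lintegral _ _

lemma dimH_centralCantorSet {a : ℝ} (ha : 0 < a) (ha' : a < 1 / 2) :
    dimH (centralCantorSet a) = ENNReal.ofReal (cantorDim a) := by
  have := isProbabilityMeasure_cantorMeasure ha ha'
  refine le_antisymm ((dimH_le_upperMinkowskiDim _).trans
    ((hasBoxBound_centralCantorSet ha ha').upperMinkowskiDim_le (cantorDim_pos ha ha').le)) ?_
  obtain ⟨K, hK, h⟩ := exists_cantorMeasure_closedBall_le ha ha'
  refine ofReal_le_dimH_of_measure_closedBall_le (ν := cantorMeasure a) (cantorDim_pos ha ha') hK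
    one_pos ?_ fun x _ r hr _ => h x r hr
  intro h0
  obtain ⟨x, hx, hx'⟩ := ((ae_mem_centralCantorSet ha ha').and
    (measure_eq_zero_iff_ae_notMem.1 h0)).exists
  exact hx' hx

end Dimension

/-! ### Uniform averaging along irrational rotations. -/

section Rotation

/-- For an irrational rotation of the circle, the Birkhoff sums of a function which is roughly
constant at a small scale are controlled uniformly by its integral. -/
lemma exists_sum_rotation_le {L β δ : ℝ} [Fact (0 < L)] (hβ : Irrational (β / L)) (hδ : 0 < δ)
    {F : AddCircle L → ℝ≥0∞} (hF : Measurable F) {K : ℝ≥0∞} (hK : K ≠ ⊤)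
    (hFK : ∀ x y, dist x y < δ → F x ≤ K * F y) :
    ∃ k₀ : ℕ, ∀ k : ℕ, k₀ ≤ k → ∀ x : AddCircle L,
      ENNReal.ofReal L * ∑ i ∈ Finset.range k, F (x + (i : ℤ) • (β : AddCircle L))
        ≤ 2 * K * k * ∫⁻ y, F y := by
  classical
  set β' : AddCircle L := (β : AddCircle L)
  have hdense : DenseRange fun j : ℤ => j • β' := AddCircle.denseRange_zsmul_coe_iff.2 hβ
  obtain ⟨S, hS⟩ := isCompact_univ.elim_finite_subcover
    (fun j : ℤ => Metric.ball (j • β') δ) (fun _ => Metric.isOpen_ball) (fun x _ => by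
      obtain ⟨j, hj⟩ := hdense.exists_dist_lt x hδ
      exact Set.mem_iUnion.2 ⟨j, hj⟩)
  obtain ⟨J, hJ⟩ : ∃ J : ℕ, ∀ j ∈ S, |j| ≤ (J : ℤ) := by
    refine ⟨S.sup Int.natAbs, fun j hj => ?_⟩
    rw [Int.abs_eq_natAbs]
    exact_mod_cast Finset.le_sup (f := Int.natAbs) hj
  -- By compactness, boundedly many steps of the orbit of `y` come within `δ` of any `x`. The orbit
  -- segment of `x` is therefore shadowed by a segment of the orbit of `y`, lengthened by `J` at
  -- each end to be independent of the shift.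
  have hsum : ∀ (k : ℕ) (x y : AddCircle L),
      ∑ i ∈ Finset.range k, F (x + (i : ℤ) • β')
        ≤ K * ∑ m ∈ Finset.Ico (-(J : ℤ)) (k + J), F (y + m • β') := by
    intro k x y
    obtain ⟨j, hj, hxy⟩ := Set.mem_iUnion₂.1 (hS (Set.mem_univ (x - y)))
    have hj' := abs_le.1 (hJ j hj)
    calc ∑ i ∈ Finset.range k, F (x + (i : ℤ) • β')
        ≤ ∑ i ∈ Finset.range k, K * F (y + ((i : ℤ) + j) • β') := by
          refine Finset.sum_le_sum fun i _ => hFK _ _ ?_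
          rw [Metric.mem_ball, dist_eq_norm] at hxy
          rw [dist_eq_norm]
          convert hxy using 2
          rw [add_smul]
          abel
      _ = K * ∑ m ∈ (Finset.range k).image (fun i : ℕ => (i : ℤ) + j), F (y + m • β') := by
          rw [Finset.sum_image (fun i _ i' _ h => by simpa using h), Finset.mul_sum]
      _ ≤ _ := by
          gcongr
          intro m hm
          obtain ⟨i, hi, rfl⟩ := Finset.mem_image.1 hm
          rw [Finset.mem_range] at hi
          rw [Finset.mem_Ico]
          constructor <;> omega
  -- Integrate the comparison over `y`: each of the `k + 2J` terms gives the same integral, and `k ≥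
  -- 2J` makes their number at most `2k`.
  refine ⟨2 * J, fun k hk x => ?_⟩
  calc ENNReal.ofReal L * ∑ i ∈ Finset.range k, F (x + (i : ℤ) • β')
      = ∫⁻ _ : AddCircle L, ∑ i ∈ Finset.range k, F (x + (i : ℤ) • β') := by
        rw [lintegral_const, AddCircle.measure_univ, mul_comm]
    _ ≤ ∫⁻ y, K * ∑ m ∈ Finset.Ico (-(J : ℤ)) (k + J), F (y + m • β') :=
        lintegral_mono fun y => hsum k x y
    _ = K * ∑ m ∈ Finset.Ico (-(J : ℤ)) (k + J), ∫⁻ y, F (y + m • β') := by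
        rw [lintegral_const_mul' _ _ hK, lintegral_finsetSum]
        exact fun m _ => hF.comp (measurable_add_const _)
    _ = K * ((k + 2 * J : ℕ) * ∫⁻ y, F y) := by
        simp_rw [lintegral_add_right_eq_self F]
        rw [Finset.sum_const, Int.card_Ico, nsmul_eq_mul]
        congr 3
        omega
    _ ≤ K * ((2 * k : ℕ) * ∫⁻ y, F y) := by
        gcongr
        omega
    _ = _ := by push_cast; ring

end Rotation

/-! ### Averaging the correlation integral over the ratio. -/

section Transversality

variable {a b : ℝ}

lemma isProbabilityMeasure_cantorConv (ha : 0 < a) (ha' : a < 1 / 2) (hb : 0 < b)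
    (hb' : b < 1 / 2) (t : ℝ) : IsProbabilityMeasure (cantorConv a b t) := by
  have := isProbabilityMeasure_cantorMeasure ha ha'
  have := isProbabilityMeasure_cantorMeasure hb hb'
  unfold cantorConv
  infer_instance

lemma correlationIntegral_cantorConv (ha : 0 < a) (ha' : a < 1 / 2) (hb : 0 < b)
    (hb' : b < 1 / 2) (t r : ℝ) :
    correlationIntegral (cantorConv a b t) r = ∫⁻ v, ∫⁻ v',
      shiftedCorrelation (cantorMeasure a) (t * (v - v')) r ∂cantorMeasure b ∂cantorMeasure b := by
  have := isProbabilityMeasure_cantorMeasure ha ha'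
  have := isProbabilityMeasure_cantorMeasure hb hb'
  have hm := measurable_shiftedCorrelation (cantorMeasure a) r
  unfold cantorConv
  rw [Measure.conv_comm, correlationIntegral_conv, lintegral_map _ (by fun_prop)]
  · refine lintegral_congr fun v => ?_
    rw [lintegral_map (by exact hm.comp (by fun_prop)) (by fun_prop)]
    simp_rw [mul_sub]
  · exact Measurable.lintegral_prod_right' (f := fun p : ℝ × ℝ =>
      shiftedCorrelation (cantorMeasure a) (p.1 - p.2) r) (hm.comp (by fun_prop))

lemma measurable_correlationIntegral_cantorConv (ha : 0 < a) (ha' : a < 1 / 2) (hb : 0 < b)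
    (hb' : b < 1 / 2) (r : ℝ) :
    Measurable fun t => correlationIntegral (cantorConv a b t) r := by
  have := isProbabilityMeasure_cantorMeasure ha ha'
  have := isProbabilityMeasure_cantorMeasure hb hb'
  have hm := measurable_shiftedCorrelation (cantorMeasure a) r
  simp_rw [correlationIntegral_cantorConv ha ha' hb hb']
  refine Measurable.lintegral_prod_right' (f := fun p : ℝ × ℝ => ∫⁻ v',
      shiftedCorrelation (cantorMeasure a) (p.1 * (p.2 - v')) r ∂cantorMeasure b) ?_
  exact Measurable.lintegral_prod_right' (f := fun p : (ℝ × ℝ) × ℝ =>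
      shiftedCorrelation (cantorMeasure a) (p.1.1 * (p.1.2 - p.2)) r) (hm.comp (by fun_prop))

lemma ae_abs_sub_le_one_cantorMeasure (ha : 0 < a) (ha' : a < 1 / 2) :
    ∀ᵐ x ∂cantorMeasure a, ∀ᵐ y ∂cantorMeasure a, |y - x| ≤ 1 := by
  filter_upwards [ae_mem_centralCantorSet ha ha'] with x hx
  filter_upwards [ae_mem_centralCantorSet ha ha'] with y hy
  have h1 := centralCantorSet_subset_Icc ha ha' hx
  have h2 := centralCantorSet_subset_Icc ha ha' hy
  rw [abs_le]
  constructor <;> linarith [h1.1, h1.2, h2.1, h2.2]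

/-- Integrating a shifted correlation integral over a family of shifts. -/
lemma setLIntegral_shiftedCorrelation_le (η : Measure ℝ) [SFinite η] {S : Set ℝ} {f : ℝ → ℝ}
    (hf : Measurable f) {r B : ℝ} (hB : ∀ x ∈ S, |f x| ≤ B) {V : ℝ≥0∞}
    (hV : ∀ z : ℝ, volume {x ∈ S | |z - f x| ≤ r} ≤ V) :
    ∫⁻ x in S, shiftedCorrelation η (f x) r ≤ V * correlationIntegral η (r + B) := by
  have hmeas : Measurable fun p : ℝ × ℝ × ℝ =>
      (Metric.closedBall (p.2.1 + f p.1) r).indicator (fun _ => (1 : ℝ≥0∞)) p.2.2 :=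
    measurable_indicator_closedBall (by fun_prop) (by fun_prop) r
  calc ∫⁻ x in S, shiftedCorrelation η (f x) r
      = ∫⁻ x in S, (∫⁻ u, (∫⁻ u', (Metric.closedBall (u + f x) r).indicator
          (fun _ => (1 : ℝ≥0∞)) u' ∂η) ∂η) := by
        refine lintegral_congr fun x => lintegral_congr fun u => ?_
        exact (lintegral_indicator_one Metric.isClosed_closedBall.measurableSet).symm
    _ = ∫⁻ u, (∫⁻ u', (∫⁻ x in S, (Metric.closedBall (u + f x) r).indicator
          (fun _ => (1 : ℝ≥0∞)) u') ∂η) ∂η := by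
        rw [lintegral_lintegral_swap]
        · refine lintegral_congr fun u => ?_
          rw [lintegral_lintegral_swap]
          exact (hmeas.comp (g := fun p : ℝ × ℝ × ℝ => _)
            (by fun_prop : Measurable fun p : ℝ × ℝ => (p.1, u, p.2))).aemeasurable
        · exact (Measurable.lintegral_prod_right' (f := fun p : (ℝ × ℝ) × ℝ =>
            (Metric.closedBall (p.1.2 + f p.1.1) r).indicator (fun _ => (1 : ℝ≥0∞)) p.2)
            (hmeas.comp (by fun_prop :
              Measurable fun p : (ℝ × ℝ) × ℝ => (p.1.1, p.1.2, p.2)))).aemeasurable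
    _ ≤ ∫⁻ u, (∫⁻ u', V * (Metric.closedBall u (r + B)).indicator
          (fun _ => (1 : ℝ≥0∞)) u' ∂η) ∂η := by
        refine lintegral_mono fun u => lintegral_mono fun u' => ?_
        dsimp only
        have hset : MeasurableSet {x | |u' - u - f x| ≤ r} :=
          measurableSet_le (by fun_prop) measurable_const
        have heq : ∀ x, (Metric.closedBall (u + f x) r).indicator (fun _ => (1 : ℝ≥0∞)) u'
            = {x | |u' - u - f x| ≤ r}.indicator (fun _ => 1) x := by
          intro x
          simp only [Set.indicator, Metric.mem_closedBall, Real.dist_eq, Set.mem_ofPred_eq,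
            sub_sub]
        simp_rw [heq]
        rw [lintegral_indicator hset, lintegral_one, Measure.restrict_apply MeasurableSet.univ,
          Set.univ_inter, Measure.restrict_apply hset]
        -- For pairs further apart than `r + B`, no parameter is admissible since the shift is at
        -- most `B`.
        by_cases h : u' ∈ Metric.closedBall u (r + B)
        · rw [Set.indicator_of_mem h, mul_one]
          refine (measure_mono fun x hx => ?_).trans (hV (u' - u))
          exact ⟨hx.2, hx.1⟩
        · rw [Set.indicator_of_notMem h, mul_zero, nonpos_iff_eq_zero]
          convert measure_empty (μ := volume)
          refine Set.eq_empty_of_forall_notMem fun x hx => h ?_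
          rw [Metric.mem_closedBall, Real.dist_eq]
          have h1 : |u' - u - f x| ≤ r := hx.1
          calc |u' - u| = |(u' - u - f x) + f x| := by congr 1; ring
            _ ≤ |u' - u - f x| + |f x| := abs_add_le _ _
            _ ≤ r + B := add_le_add h1 (hB x hx.2)
    _ = V * correlationIntegral η (r + B) := by
        unfold correlationIntegral
        rw [← lintegral_const_mul _ (measurable_measure_closedBall η (r + B))]
        refine lintegral_congr fun u => ?_
        rw [lintegral_const_mul _ (measurable_indicator_closedBall measurable_const
          measurable_id' _)]
        congr 1
        exact lintegral_indicator_one Metric.isClosed_closedBall.measurableSet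

lemma exp_sub_exp_le (x y : ℝ) : Real.exp x - Real.exp y ≤ Real.exp x * (x - y) := by
  have h := Real.add_one_le_exp (y - x)
  have h2 : Real.exp y = Real.exp x * Real.exp (y - x) := by rw [← Real.exp_add]; congr 1; ring
  have := Real.exp_pos x
  rw [h2]
  nlinarith

/-- On `(-L, 0]` the map `x ↦ c e^x` has speed at least `|c| e^{-L}`, so the preimage of an interval
of length `2r` has diameter at most `2 r e^L / |c|`. This is the transversality estimate. -/
lemma volume_exp_le {L r c : ℝ} (hc : c ≠ 0) (hr : 0 ≤ r) (z : ℝ) :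
    volume {x ∈ Set.Ioc (-L) 0 | |z - c * Real.exp x| ≤ r}
      ≤ ENNReal.ofReal (2 * r * Real.exp L / |c|) := by
  have hc' : 0 < |c| := abs_pos.2 hc
  refine (Real.volume_le_diam _).trans (Metric.ediam_le fun x hx y hy => ?_)
  rw [edist_dist]
  apply ENNReal.ofReal_le_ofReal
  have key : ∀ x y : ℝ, -L < y → |z - c * Real.exp x| ≤ r → |z - c * Real.exp y| ≤ r →
      x - y ≤ 2 * r * Real.exp L / |c| := by
    intro x y hyL hx hy
    have h1 := exp_sub_exp_le y x
    have h2 : |c| * (Real.exp x - Real.exp y) ≤ 2 * r := by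
      calc |c| * (Real.exp x - Real.exp y) ≤ |c| * |Real.exp x - Real.exp y| := by
            gcongr; exact le_abs_self _
        _ = |(z - c * Real.exp y) - (z - c * Real.exp x)| := by
            rw [← abs_mul]; congr 1; ring
        _ ≤ r + r := (abs_sub _ _).trans (add_le_add hy hx)
        _ = 2 * r := by ring
    have h3 : Real.exp (-L) ≤ Real.exp y := Real.exp_le_exp.2 hyL.le
    rw [le_div_iff₀ hc']
    rcases le_or_gt (x - y) 0 with h | h
    · exact (mul_nonpos_of_nonpos_of_nonneg h hc'.le).trans (by positivity)
    · have h4 : |c| * (Real.exp (-L) * (x - y)) ≤ 2 * r := by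
        refine le_trans ?_ h2
        gcongr
        nlinarith
      calc (x - y) * |c| = |c| * (Real.exp (-L) * (x - y)) * Real.exp L := by
            rw [Real.exp_neg]; field_simp
        _ ≤ 2 * r * Real.exp L := by gcongr
  rw [Real.dist_eq, abs_le]
  have h1 := key x y hy.1.1 hx.2 hy.2
  have h2 := key y x hx.1.1 hy.2 hx.2
  constructor <;> linarith

/-- The average over `x` of the correlation integrals with ratio `t e^x`. -/
lemma exists_setLIntegral_correlationIntegral_le (ha : 0 < a) (ha' : a < 1 / 2) (hb : 0 < b)
    (hb' : b < 1 / 2) {t L α : ℝ} (ht : t ≠ 0) (hL : 0 < L) (hα1 : α ≤ 1)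
    (hα : α ≤ cantorDim a + cantorDim b) :
    ∃ K : ℝ, 0 < K ∧ ∀ N : ℕ,
      ∫⁻ x in Set.Ioc (-L) 0, correlationIntegral (cantorConv a b (t * Real.exp x)) (a ^ N)
        ≤ ENNReal.ofReal (K * (N + 1) * (a ^ α) ^ N) := by
  have := isProbabilityMeasure_cantorMeasure ha ha'
  have := isProbabilityMeasure_cantorMeasure hb hb'
  obtain ⟨Ka, hKa, hA⟩ := exists_correlationIntegral_cantorMeasure_le ha ha'
  obtain ⟨Kb, hKb, hB⟩ := exists_cantorMeasure_closedBall_le hb hb'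
  have hm := fun r => measurable_shiftedCorrelation (cantorMeasure a) r
  have ht' : 0 < |t| := abs_pos.2 ht
  -- The summand `L` serves the differences below `a^N`, where all parameters are counted; the other
  -- summand is the transversality constant, with `1 / a` from rounding `|w|` to a power of `a`.
  set M : ℝ := Ka * (1 + |t|) ^ cantorDim a * (L + 2 * Real.exp L / (|t| * a)) with hM
  have hMpos : 0 < M := by positivity
  have hda := cantorDim_pos ha ha'
  have hdb := cantorDim_pos hb hb'
  refine ⟨M * Kb, by positivity, fun N => ?_⟩
  -- For `|w|` of order `a^k`: `a^(N - k)` is the measure of admissible parameters for a given pair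
  -- of points of `C_a`, and the last factor is the correlation integral of `μ_a` at scale `a^k`.
  set c : ℕ → ℝ := fun k => M * a ^ (N - k) * (a ^ k) ^ cantorDim a with hc
  have hcpos : ∀ k, 0 < c k := fun k => by positivity
  have hC : ∀ k : ℕ, correlationIntegral (cantorMeasure a) (a ^ k + |t| * a ^ k)
      ≤ ENNReal.ofReal (Ka * (1 + |t|) ^ cantorDim a * (a ^ k) ^ cantorDim a) := by
    intro k
    refine (hA _ (by positivity)).trans (le_of_eq ?_)
    rw [mul_assoc, ← Real.mul_rpow (by positivity) (by positivity)]
    congr 3; ring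
  -- Only one `k` is needed for a given `w`. Summing over all `k ≤ N` instead turns the bound into
  -- indicators of balls, to be integrated against `μ_b`, at the cost of the factor `N + 1`.
  have hH : ∀ w : ℝ, |w| ≤ 1 →
      ∫⁻ x in Set.Ioc (-L) 0, shiftedCorrelation (cantorMeasure a) (t * Real.exp x * w) (a ^ N)
      ≤ ∑ k ∈ Finset.range (N + 1), ENNReal.ofReal (c k) *
          (if |w| ≤ a ^ k then 1 else 0) := by
    intro w hw
    have hbd : ∀ k : ℕ, |w| ≤ a ^ k → ∀ x ∈ Set.Ioc (-L) 0,
        |t * Real.exp x * w| ≤ |t| * a ^ k := by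
      intro k hk x hx
      rw [abs_mul, abs_mul, Real.abs_exp]
      have : Real.exp x ≤ 1 := Real.exp_le_one_iff.2 hx.2
      calc |t| * Real.exp x * |w| ≤ |t| * 1 * a ^ k := by gcongr
        _ = _ := by ring
    obtain ⟨k, hkN, hwk, hHk⟩ : ∃ k ≤ N, |w| ≤ a ^ k ∧
        ∫⁻ x in Set.Ioc (-L) 0, shiftedCorrelation (cantorMeasure a) (t * Real.exp x * w) (a ^ N)
          ≤ ENNReal.ofReal (c k) := by
      rcases le_or_gt |w| (a ^ N) with hN | hN
      · refine ⟨N, le_rfl, hN, ?_⟩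
        refine (setLIntegral_shiftedCorrelation_le (cantorMeasure a)
          (by fun_prop) (hbd N hN) (V := ENNReal.ofReal L) fun z => ?_).trans ?_
        · refine (measure_mono (Set.sep_subset _ _)).trans ?_
          simp
        · refine (mul_le_mul_right (hC N) _).trans ?_
          rw [← ENNReal.ofReal_mul hL.le]
          apply ENNReal.ofReal_le_ofReal
          rw [hc]
          simp only [Nat.sub_self, pow_zero, mul_one, hM]
          have h0 : 0 ≤ 2 * Real.exp L / (|t| * a) := by positivity
          have h1 : 0 ≤ Ka * (1 + |t|) ^ cantorDim a * (a ^ N) ^ cantorDim a := by positivity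
          nlinarith
      · have hw0 : 0 < |w| := lt_trans (by positivity) hN
        obtain ⟨k, hk1, hk2⟩ := exists_nat_pow_near_of_lt_one hw0 hw ha (by linarith : a < 1)
        have hkN : k < N := by
          by_contra! h
          have := pow_le_pow_of_le_one ha.le (by linarith) h
          linarith
        refine ⟨k, hkN.le, hk2, ?_⟩
        have hmono : a ^ N ≤ a ^ k := pow_le_pow_of_le_one ha.le (by linarith) hkN.le
        refine (setLIntegral_shiftedCorrelation_le (cantorMeasure a)
          (by fun_prop) (hbd k hk2)
          (V := ENNReal.ofReal (2 * Real.exp L / (|t| * a) * a ^ (N - k))) fun z => ?_).trans ?_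
        · have hwne : w ≠ 0 := abs_pos.1 hw0
          have heq : {x ∈ Set.Ioc (-L) 0 | |z - t * Real.exp x * w| ≤ a ^ N}
              = {x ∈ Set.Ioc (-L) 0 | |z - t * w * Real.exp x| ≤ a ^ N} := by
            simp_rw [mul_right_comm t]
          rw [heq]
          refine (volume_exp_le (mul_ne_zero ht hwne) (by positivity) z).trans ?_
          apply ENNReal.ofReal_le_ofReal
          have hpow : a ^ N = a ^ (N - k) * a ^ k := by rw [← pow_add]; congr 1; omega
          rw [abs_mul, div_le_iff₀ (by positivity)]
          calc 2 * a ^ N * Real.exp L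
              = 2 * Real.exp L / (|t| * a) * a ^ (N - k) * (|t| * a ^ (k + 1)) := by
                rw [hpow, pow_succ]; field_simp
            _ ≤ _ := by gcongr
        · refine (mul_le_mul_right ((correlationIntegral_mono _
            (add_le_add_left hmono _)).trans (hC k)) _).trans ?_
          rw [← ENNReal.ofReal_mul (by positivity)]
          apply ENNReal.ofReal_le_ofReal
          rw [hc]
          simp only [hM]
          have h1 : 0 ≤ Ka * (1 + |t|) ^ cantorDim a * (a ^ k) ^ cantorDim a * a ^ (N - k) * L := by
            positivity
          nlinarith
    refine hHk.trans ?_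
    have := Finset.single_le_sum (f := fun k => ENNReal.ofReal (c k) *
      (if |w| ≤ a ^ k then (1 : ℝ≥0∞) else 0)) (fun _ _ => zero_le)
      (Finset.mem_range.2 (Nat.lt_succ_of_le hkN))
    simpa [hwk] using this
  have hm2 : Measurable fun p : (ℝ × ℝ) × ℝ => shiftedCorrelation (cantorMeasure a)
      (t * Real.exp p.1.1 * (p.1.2 - p.2)) (a ^ N) := (hm _).comp (by fun_prop)
  calc ∫⁻ x in Set.Ioc (-L) 0, correlationIntegral (cantorConv a b (t * Real.exp x)) (a ^ N)
      = ∫⁻ v, (∫⁻ v', (∫⁻ x in Set.Ioc (-L) 0, shiftedCorrelation (cantorMeasure a)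
          (t * Real.exp x * (v - v')) (a ^ N)) ∂cantorMeasure b) ∂cantorMeasure b := by
        simp_rw [correlationIntegral_cantorConv ha ha' hb hb']
        rw [lintegral_lintegral_swap]
        · refine lintegral_congr fun v => ?_
          rw [lintegral_lintegral_swap]
          exact (hm2.comp (by fun_prop :
            Measurable fun p : ℝ × ℝ => ((p.1, v), p.2))).aemeasurable
        · exact hm2.lintegral_prod_right'.aemeasurable
    _ ≤ ∫⁻ v, (∫⁻ v', ∑ k ∈ Finset.range (N + 1), ENNReal.ofReal (c k) *
          (Metric.closedBall v (a ^ k)).indicator (fun _ => (1 : ℝ≥0∞)) v'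
          ∂cantorMeasure b) ∂cantorMeasure b := by
        refine lintegral_mono_ae ?_
        filter_upwards [ae_abs_sub_le_one_cantorMeasure hb hb'] with v hv
        refine lintegral_mono_ae ?_
        filter_upwards [hv] with v' hv'
        rw [abs_sub_comm] at hv'
        refine (hH _ hv').trans (le_of_eq ?_)
        refine Finset.sum_congr rfl fun k _ => ?_
        simp only [Set.indicator, Metric.mem_closedBall, Real.dist_eq, abs_sub_comm v']
    _ ≤ ∫⁻ _, ENNReal.ofReal (M * Kb * (N + 1) * (a ^ α) ^ N) ∂cantorMeasure b := by
        refine lintegral_mono fun v => ?_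
        dsimp only
        have hmk : ∀ k, Measurable fun v' => (Metric.closedBall v (a ^ k)).indicator
            (fun _ => (1 : ℝ≥0∞)) v' := fun k =>
          measurable_indicator_closedBall measurable_const measurable_id' _
        rw [lintegral_finsetSum _ fun k _ => (hmk k).const_mul _]
        calc _ ≤ ∑ k ∈ Finset.range (N + 1), ENNReal.ofReal (M * Kb * (a ^ α) ^ N) := by
              refine Finset.sum_le_sum fun k hk => ?_
              have hkN : k ≤ N := Nat.lt_succ_iff.1 (Finset.mem_range.1 hk)
              rw [lintegral_const_mul _ (hmk k)]
              have h1 : ∫⁻ v', (Metric.closedBall v (a ^ k)).indicator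
                  (fun _ => (1 : ℝ≥0∞)) v' ∂cantorMeasure b
                  = cantorMeasure b (Metric.closedBall v (a ^ k)) :=
                lintegral_indicator_one Metric.isClosed_closedBall.measurableSet
              rw [h1]
              refine (mul_le_mul_right (hB v (a ^ k) (by positivity)) _).trans ?_
              rw [← ENNReal.ofReal_mul (hcpos k).le]
              apply ENNReal.ofReal_le_ofReal
              have hak : 0 < a ^ k := by positivity
              have hak1 : a ^ k ≤ 1 := pow_le_one₀ ha.le (by linarith)
              have hank : 0 < a ^ (N - k) := by positivity
              have hank1 : a ^ (N - k) ≤ 1 := pow_le_one₀ ha.le (by linarith)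
              -- The scales above `a^k` use the exponent `cantorDim a + cantorDim b`, those from
              -- `a^k` down to `a^N` the exponent `1`; both are at least `α`, so every `k` gives the
              -- same bound `a^{αN}`.
              have e1 : (a ^ k) ^ cantorDim a * (a ^ k) ^ cantorDim b ≤ (a ^ k) ^ α := by
                rw [← Real.rpow_add hak]
                exact Real.rpow_le_rpow_of_exponent_ge hak hak1 hα
              have e2 : a ^ (N - k) ≤ (a ^ (N - k)) ^ α := by
                conv_lhs => rw [← Real.rpow_one (a ^ (N - k))]
                exact Real.rpow_le_rpow_of_exponent_ge hank hank1 hα1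
              have e3 : (a ^ (N - k)) ^ α * (a ^ k) ^ α = (a ^ α) ^ N := by
                rw [← Real.mul_rpow hank.le hak.le, ← pow_add, Nat.sub_add_cancel hkN,
                  ← Real.rpow_natCast, ← Real.rpow_natCast, ← Real.rpow_mul ha.le,
                  ← Real.rpow_mul ha.le, mul_comm]
              calc c k * (Kb * (a ^ k) ^ cantorDim b)
                  = M * Kb * (a ^ (N - k) * ((a ^ k) ^ cantorDim a * (a ^ k) ^ cantorDim b)) := by
                    rw [hc]; ring
                _ ≤ M * Kb * ((a ^ (N - k)) ^ α * (a ^ k) ^ α) := by gcongr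
                _ = _ := by rw [e3]
          _ = _ := by
              rw [Finset.sum_const, Finset.card_range, nsmul_eq_mul, ← ENNReal.ofReal_natCast,
                ← ENNReal.ofReal_mul (by positivity)]
              congr 1
              push_cast
              ring
    _ = _ := by simp

end Transversality

/-! ### Submultiplicativity in the scale and dependence on the ratio. -/

section Submultiplicativity

variable {a b : ℝ}

lemma ae_mem_image2_cantorConv (ha : 0 < a) (ha' : a < 1 / 2) (hb : 0 < b) (hb' : b < 1 / 2)
    (t : ℝ) : ∀ᵐ x ∂cantorConv a b t,
      x ∈ Set.image2 (fun x y => x + t * y) (centralCantorSet a) (centralCantorSet b) := by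
  have := isProbabilityMeasure_cantorMeasure ha ha'
  have := isProbabilityMeasure_cantorMeasure hb hb'
  have hcpt : IsCompact (Set.image2 (fun x y => x + t * y) (centralCantorSet a)
      (centralCantorSet b)) := by
    rw [← Set.image_prod]
    exact ((isCompact_centralCantorSet ha ha').prod (isCompact_centralCantorSet hb hb')).image
      (by fun_prop)
  have heq : cantorConv a b t
      = ((cantorMeasure a).prod (cantorMeasure b)).map fun p => p.1 + t * p.2 := by
    unfold cantorConv
    conv_lhs => rw [← Measure.map_id (μ := cantorMeasure a)]
    rw [Measure.conv, Measure.map_prod_map _ _ measurable_id (by fun_prop),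
      Measure.map_map (by fun_prop) (by fun_prop)]
    rfl
  rw [heq]
  refine (ae_map_iff (by fun_prop) hcpt.isClosed.measurableSet).2 ?_
  have h1 : ∀ᵐ p ∂(cantorMeasure a).prod (cantorMeasure b), p.1 ∈ centralCantorSet a :=
    Measure.quasiMeasurePreserving_fst.ae (ae_mem_centralCantorSet ha ha')
  have h2 : ∀ᵐ p ∂(cantorMeasure a).prod (cantorMeasure b), p.2 ∈ centralCantorSet b :=
    Measure.quasiMeasurePreserving_snd.ae (ae_mem_centralCantorSet hb hb')
  filter_upwards [h1, h2] with p hp1 hp2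
  exact ⟨p.1, hp1, p.2, hp2, rfl⟩

lemma ae_mem_Icc_cantorConv (ha : 0 < a) (ha' : a < 1 / 2) (hb : 0 < b) (hb' : b < 1 / 2)
    (t : ℝ) : ∀ᵐ x ∂cantorConv a b t, x ∈ Set.Icc (-|t|) (1 + |t|) := by
  filter_upwards [ae_mem_image2_cantorConv ha ha' hb hb' t]
  rintro _ ⟨x, hx, y, hy, rfl⟩
  have h1 := centralCantorSet_subset_Icc ha ha' hx
  have h2 := centralCantorSet_subset_Icc hb hb' hy
  have h3 : |t * y| ≤ |t| := by
    rw [abs_mul, abs_of_nonneg h2.1]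
    exact mul_le_of_le_one_right (abs_nonneg t) h2.2
  rw [abs_le] at h3
  constructor <;> linarith [h1.1, h1.2]

lemma ae_ae_abs_sub_le_of_ae_mem_Icc {η : Measure ℝ} {p q : ℝ} (h : ∀ᵐ x ∂η, x ∈ Set.Icc p q) :
    ∀ᵐ x ∂η, ∀ᵐ y ∂η, |y - x| ≤ q - p := by
  filter_upwards [h] with x hx
  filter_upwards [h] with y hy
  rw [abs_le]
  constructor <;> linarith [hx.1, hx.2, hy.1, hy.2]

lemma ae_mem_Icc_map_mul {η : Measure ℝ} {p q δ : ℝ} (hδ : 0 < δ)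
    (h : ∀ᵐ x ∂η, x ∈ Set.Icc p q) :
    ∀ᵐ x ∂η.map (fun x => δ * x), x ∈ Set.Icc (δ * p) (δ * q) := by
  refine (ae_map_iff (by fun_prop) measurableSet_Icc).2 ?_
  filter_upwards [h] with x hx
  exact ⟨by have := hx.1; gcongr, by have := hx.2; gcongr⟩

/-- The self-similarity of the measures `cantorConv a b t`. -/
lemma exists_cantorConv_eq_conv (ha : 0 < a) (ha' : a < 1 / 2) (hb : 0 < b) (hb' : b < 1 / 2)
    (n m : ℕ) (t : ℝ) :
    ∃ ρ : Measure ℝ, IsProbabilityMeasure ρ ∧ cantorConv a b t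
      = ρ ∗ (cantorConv a b (t * b ^ m / a ^ n)).map fun x => a ^ n * x := by
  have := isProbabilityMeasure_cantorMeasure ha ha'
  have := isProbabilityMeasure_cantorMeasure hb hb'
  obtain ⟨κ, hκ, h1⟩ := exists_cantorMeasure_eq_conv_pow ha ha' n
  obtain ⟨κ', hκ', h2⟩ := exists_cantorMeasure_eq_conv_pow hb hb' m
  refine ⟨κ ∗ κ'.map fun x => t * x, inferInstance, ?_⟩
  have h3 : a ^ n * (t * b ^ m / a ^ n) = t * b ^ m := by field_simp
  unfold cantorConv
  rw [map_mul_conv, map_mul_map_mul, h3]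
  conv_lhs => rw [h1, h2]
  rw [map_mul_conv, map_mul_map_mul]
  rw [Measure.conv_assoc, Measure.conv_assoc]
  congr 1
  rw [← Measure.conv_assoc, ← Measure.conv_assoc, Measure.conv_comm (κ'.map _)]

/-- Submultiplicativity of the correlation integrals of `cantorConv a b t` in the scale. -/
lemma exists_correlationIntegral_cantorConv_mul_le (ha : 0 < a) (ha' : a < 1 / 2) (hb : 0 < b)
    (hb' : b < 1 / 2) (B : ℝ) :
    ∃ K : ℝ, 0 < K ∧ ∀ (n m : ℕ) (t : ℝ), |t * b ^ m / a ^ n| ≤ B → ∀ r : ℝ, 0 < r → r ≤ 1 →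
      correlationIntegral (cantorConv a b t) (a ^ n * r)
        ≤ ENNReal.ofReal K * correlationIntegral (cantorConv a b t) (a ^ n)
          * correlationIntegral (cantorConv a b (t * b ^ m / a ^ n)) r := by
  -- Passing to `ρ` and back enlarges the radius to `a^n (r + 2 (1 + 2|t'|))`, where `t'` is the new
  -- ratio. Since `r ≤ 1` and `|t'| ≤ B`, `p` doublings bring it back to `a^n`.
  obtain ⟨p, hp⟩ := pow_unbounded_of_one_lt (1 + 2 * (1 + 2 * B)) one_lt_two
  refine ⟨64 * 16 ^ p, by positivity, fun n m t hB r hr hr1 => ?_⟩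
  have := isProbabilityMeasure_cantorConv ha ha' hb hb' t
  have := isProbabilityMeasure_cantorConv ha ha' hb hb' (t * b ^ m / a ^ n)
  obtain ⟨ρ, hρ, h⟩ := exists_cantorConv_eq_conv ha ha' hb hb' n m t
  set t' := t * b ^ m / a ^ n
  have han : 0 < a ^ n := by positivity
  have hD := ae_ae_abs_sub_le_of_ae_mem_Icc
    (ae_mem_Icc_map_mul han (ae_mem_Icc_cantorConv ha ha' hb hb' t'))
  set D : ℝ := a ^ n * (1 + |t'|) - a ^ n * -|t'| with hDdef
  have h1 : correlationIntegral (cantorConv a b t) (a ^ n * r)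
      ≤ 64 * correlationIntegral ρ (a ^ n * r + D)
        * correlationIntegral (cantorConv a b t') r := by
    conv_lhs => rw [h]
    refine (correlationIntegral_conv_le _ _ (by positivity) hD).trans ?_
    rw [correlationIntegral_map_mul _ han]
  have h2 : correlationIntegral ρ (a ^ n * r + D)
      ≤ 16 ^ p * correlationIntegral (cantorConv a b t) (a ^ n) := by
    refine (correlationIntegral_le_conv ρ _ hD).trans ?_
    rw [← h]
    refine (correlationIntegral_mono _ ?_).trans (correlationIntegral_two_pow_mul_le _ p han)
    rw [hDdef]
    have h3 : a ^ n * r + (a ^ n * (1 + |t'|) - a ^ n * -|t'|)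
        + (a ^ n * (1 + |t'|) - a ^ n * -|t'|) = (r + 2 * (1 + 2 * |t'|)) * a ^ n := by ring
    rw [h3]
    gcongr
    linarith
  refine h1.trans ?_
  calc 64 * correlationIntegral ρ (a ^ n * r + D) * correlationIntegral (cantorConv a b t') r
      ≤ 64 * (16 ^ p * correlationIntegral (cantorConv a b t) (a ^ n))
        * correlationIntegral (cantorConv a b t') r := by gcongr
    _ = _ := by
      rw [ENNReal.ofReal_mul (by norm_num), ENNReal.ofReal_pow (by norm_num),
        ENNReal.ofReal_ofNat, ENNReal.ofReal_ofNat]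
      ring

/-- Splitting one digit off `μ_b` makes the ratios `t` and `t b` comparable at equal scale. This is
needed where the circle of ratios modulo `b` is cut open. -/
lemma cantorConv_eq_conv_firstDigit (ha : 0 < a) (ha' : a < 1 / 2) (hb : 0 < b)
    (hb' : b < 1 / 2) (t : ℝ) :
    cantorConv a b t = ((firstDigitLaw b).map fun x => t * x) ∗ cantorConv a b (t * b) := by
  have := isProbabilityMeasure_cantorMeasure ha ha'
  have := isProbabilityMeasure_cantorMeasure hb hb'
  unfold cantorConv
  conv_lhs => rw [cantorMeasure_eq_conv hb hb']
  rw [map_mul_conv, map_mul_map_mul, ← Measure.conv_assoc, ← Measure.conv_assoc,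
    Measure.conv_comm (cantorMeasure a)]

lemma correlationIntegral_cantorConv_le_mul (ha : 0 < a) (ha' : a < 1 / 2) (hb : 0 < b)
    (hb' : b < 1 / 2) (t : ℝ) {r : ℝ} (hr : 0 < r) :
    correlationIntegral (cantorConv a b t) r
      ≤ 64 * correlationIntegral (cantorConv a b (t * b)) r := by
  have := isProbabilityMeasure_cantorConv ha ha' hb hb' (t * b)
  rw [cantorConv_eq_conv_firstDigit ha ha' hb hb' t]
  exact correlationIntegral_conv_le' _ _ hr

/-- Two independent first digits are both `0` with probability `1/4`, and then no shift occurs. -/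
lemma correlationIntegral_cantorConv_mul_le (ha : 0 < a) (ha' : a < 1 / 2) (hb : 0 < b)
    (hb' : b < 1 / 2) (t r : ℝ) :
    correlationIntegral (cantorConv a b (t * b)) r
      ≤ 4 * correlationIntegral (cantorConv a b t) r := by
  have := isProbabilityMeasure_cantorConv ha ha' hb hb' (t * b)
  rw [cantorConv_eq_conv_firstDigit ha ha' hb hb' t, correlationIntegral_conv]
  have hm := measurable_shiftedCorrelation (cantorConv a b (t * b)) r
  have key : ∀ f : ℝ → ℝ≥0∞, Measurable f →
      2⁻¹ * f 0 ≤ ∫⁻ z, f z ∂(firstDigitLaw b).map fun x => t * x := fun f hf => by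
    rw [lintegral_map hf (by fun_prop), lintegral_firstDigitLaw _ (by fun_prop), mul_zero]
    exact le_self_add
  have h1 := key (fun z => ∫⁻ z', shiftedCorrelation (cantorConv a b (t * b)) (z - z') r
      ∂(firstDigitLaw b).map fun x => t * x)
    (Measurable.lintegral_prod_right' (f := fun p : ℝ × ℝ =>
      shiftedCorrelation (cantorConv a b (t * b)) (p.1 - p.2) r) (hm.comp (by fun_prop)))
  have h2 := key (fun z' => shiftedCorrelation (cantorConv a b (t * b)) (0 - z') r)
    (hm.comp (by fun_prop))
  simp only [sub_zero, shiftedCorrelation_zero] at h2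
  calc correlationIntegral (cantorConv a b (t * b)) r
      = 4 * (2⁻¹ * (2⁻¹ * correlationIntegral (cantorConv a b (t * b)) r)) := by
        rw [← mul_assoc, ← mul_assoc]
        have : (4 : ℝ≥0∞) * 2⁻¹ * 2⁻¹ = 1 := by
          rw [show (4 : ℝ≥0∞) = 2 * 2 by norm_num, mul_assoc 2 2, ENNReal.mul_inv_cancel (by simp) (by simp),
            mul_one, ENNReal.mul_inv_cancel (by simp) (by simp)]
        rw [this, one_mul]
    _ ≤ _ := by
        gcongr
        refine le_trans ?_ h1
        gcongr

/-- Since `|v - v'| ≤ 1` almost surely, changing the ratio by at most `r` moves the shifts by at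
most `r`; doubling absorbs this. -/
lemma correlationIntegral_cantorConv_le_of_abs_sub_le (ha : 0 < a) (ha' : a < 1 / 2) (hb : 0 < b)
    (hb' : b < 1 / 2) {t t' r : ℝ} (hr : 0 < r) (h : |t - t'| ≤ r) :
    correlationIntegral (cantorConv a b t) r
      ≤ 16 * correlationIntegral (cantorConv a b t') r := by
  have := isProbabilityMeasure_cantorConv ha ha' hb hb' t'
  refine le_trans ?_ (correlationIntegral_two_mul_le _ hr)
  rw [correlationIntegral_cantorConv ha ha' hb hb', correlationIntegral_cantorConv ha ha' hb hb']
  refine lintegral_mono_ae ?_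
  filter_upwards [ae_abs_sub_le_one_cantorMeasure hb hb'] with v hv
  refine lintegral_mono_ae ?_
  filter_upwards [hv] with v' hv'
  refine lintegral_mono fun u => measure_mono (Metric.closedBall_subset_closedBall' ?_)
  rw [Real.dist_eq, add_sub_add_left_eq_sub, ← sub_mul, abs_mul, abs_sub_comm v]
  have : |t - t'| * |v' - v| ≤ r * 1 := by gcongr
  linarith

end Submultiplicativity

/-! ### The circle of ratios modulo `b` and the product along a rotation orbit. -/

section Orbit

variable {a b : ℝ}

/-- The representative in `(-L, 0]` of a point of the circle of length `L`. -/
noncomputable def circleRep (L : ℝ) [Fact (0 < L)] (y : AddCircle L) : ℝ :=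
  (AddCircle.equivIoc L (-L) y : ℝ)

variable {L : ℝ} [Fact (0 < L)]

lemma circleRep_mem (y : AddCircle L) : circleRep L y ∈ Set.Ioc (-L) 0 := by
  have := (AddCircle.equivIoc L (-L) y).2
  exact ⟨this.1, this.2.trans_eq (neg_add_cancel L)⟩

lemma coe_circleRep (y : AddCircle L) : ((circleRep L y : ℝ) : AddCircle L) = y :=
  AddCircle.coe_equivIoc

lemma circleRep_coe {x : ℝ} (hx : x ∈ Set.Ioc (-L) 0) : circleRep L (x : AddCircle L) = x :=
  AddCircle.equivIoc_coe_of_mem (by rwa [neg_add_cancel])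

lemma measurable_circleRep : Measurable (circleRep L) :=
  measurable_subtype_coe.comp (AddCircle.measurableEquivIoc L (-L)).measurable

/-- The correlation integral of `cantorConv a b (t e^x)` at scale `r`, as a function of the class
of `x` modulo `L`. -/
noncomputable def circleCorrelation (a b t r : ℝ) (L : ℝ) [Fact (0 < L)] (y : AddCircle L) : ℝ≥0∞ :=
  correlationIntegral (cantorConv a b (t * Real.exp (circleRep L y))) r

lemma measurable_circleCorrelation (ha : 0 < a) (ha' : a < 1 / 2) (hb : 0 < b) (hb' : b < 1 / 2)
    (t r : ℝ) : Measurable (circleCorrelation a b t r L) :=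
  (measurable_correlationIntegral_cantorConv ha ha' hb hb' r).comp
    (measurable_const.mul (Real.measurable_exp.comp measurable_circleRep))

lemma lintegral_circleCorrelation (t r : ℝ) :
    ∫⁻ y, circleCorrelation a b t r L y = ∫⁻ x in Set.Ioc (-L) 0,
      correlationIntegral (cantorConv a b (t * Real.exp x)) r := by
  rw [← AddCircle.lintegral_preimage L (-L), neg_add_cancel]
  refine setLIntegral_congr_fun measurableSet_Ioc fun x hx => ?_
  simp only [circleCorrelation, circleRep_coe hx]

lemma abs_exp_sub_exp_le {x y M : ℝ} (hx : x ≤ M) (hy : y ≤ M) :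
    |Real.exp x - Real.exp y| ≤ Real.exp M * |x - y| := by
  have key : ∀ x y : ℝ, x ≤ M → Real.exp x - Real.exp y ≤ Real.exp M * |x - y| := by
    intro x y hx
    refine (exp_sub_exp_le x y).trans ?_
    have h1 := Real.exp_le_exp.2 hx
    have h2 := Real.exp_pos x
    calc Real.exp x * (x - y) ≤ Real.exp x * |x - y| := by gcongr; exact le_abs_self _
      _ ≤ _ := by gcongr
  rw [abs_le]
  have h1 := key x y hx
  have h2 := key y x hy
  rw [abs_sub_comm] at h2
  constructor <;> linarith

/-- At a small scale on the circle, `circleCorrelation` is constant up to a bounded factor. -/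
lemma exists_circleCorrelation_le (ha : 0 < a) (ha' : a < 1 / 2) (hb : 0 < b)
    (hb' : b < 1 / 2) (hL : Real.exp (-L) = b) (t : ℝ) {r : ℝ} (hr : 0 < r) :
    ∃ δ : ℝ, 0 < δ ∧ ∀ x y : AddCircle L, dist x y < δ →
      circleCorrelation a b t r L x ≤ 1024 * circleCorrelation a b t r L y := by
  have hL0 : 0 < L := Fact.out
  have hM : 0 < (|t| + 1) * Real.exp L := by positivity
  refine ⟨min L (r / ((|t| + 1) * Real.exp L)), by positivity, fun x y hxy => ?_⟩
  have hx := circleRep_mem x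
  have hy := circleRep_mem y
  set u := circleRep L x with hu
  set v := circleRep L y with hv
  obtain ⟨n, hn⟩ : ∃ n : ℤ, |u - v - n * L| < min L (r / ((|t| + 1) * Real.exp L)) := by
    rw [dist_eq_norm, ← coe_circleRep x, ← coe_circleRep y, ← AddCircle.coe_sub,
      AddCircle.norm_eq] at hxy
    exact ⟨_, hxy⟩
  obtain ⟨hn1, hn2⟩ := lt_min_iff.1 hn
  have near : ∀ w : ℝ, w ≤ L → |u - w| < r / ((|t| + 1) * Real.exp L) →
      correlationIntegral (cantorConv a b (t * Real.exp u)) r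
        ≤ 16 * correlationIntegral (cantorConv a b (t * Real.exp w)) r := by
    intro w hw huw
    refine correlationIntegral_cantorConv_le_of_abs_sub_le ha ha' hb hb' hr ?_
    rw [lt_div_iff₀ hM] at huw
    rw [← mul_sub, abs_mul]
    have := abs_exp_sub_exp_le (hx.2.trans hL0.le) hw
    calc |t| * |Real.exp u - Real.exp w| ≤ (|t| + 1) * (Real.exp L * |u - w|) := by
          gcongr; linarith
      _ = |u - w| * ((|t| + 1) * Real.exp L) := by ring
      _ ≤ r := huw.le
  have hstep : ∀ w : ℝ, t * Real.exp w * b = t * Real.exp (w - L) := fun w => by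
    rw [sub_eq_add_neg, Real.exp_add, hL, mul_assoc]
  have hn3 : -2 < n ∧ n < 2 := by
    rw [abs_lt] at hn1
    constructor
    · have : (-2 : ℝ) * L < n * L := by linarith [hx.1, hx.2, hy.1, hy.2]
      exact_mod_cast lt_of_mul_lt_mul_right this hL0.le
    · have : (n : ℝ) * L < 2 * L := by linarith [hx.1, hx.2, hy.1, hy.2]
      exact_mod_cast lt_of_mul_lt_mul_right this hL0.le
  unfold circleCorrelation
  rw [← hu, ← hv]
  -- If `n ≠ 0` the representatives lie on opposite sides of the cut. One replaces `v` by `v + n L`,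
  -- close to `u`, and returns by multiplying or dividing the ratio by `b`; the worst factor is `16
  -- * 64 = 1024`.
  obtain rfl | rfl | rfl : n = -1 ∨ n = 0 ∨ n = 1 := by omega
  · have h1 := near (v - L) (by linarith [hy.2]) (by
      rwa [show u - (v - L) = u - v - ((-1 : ℤ) : ℝ) * L by push_cast; ring])
    have h2 := correlationIntegral_cantorConv_mul_le ha ha' hb hb' (t * Real.exp v) r
    rw [hstep] at h2
    refine h1.trans ((mul_le_mul_right h2 16).trans ?_)
    rw [← mul_assoc]
    gcongr
    norm_num
  · have h1 := near v (by linarith [hy.2]) (by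
      rwa [show u - v = u - v - ((0 : ℤ) : ℝ) * L by push_cast; ring])
    refine h1.trans ?_
    gcongr
    norm_num
  · have h1 := near (v + L) (by linarith [hy.2]) (by
      rwa [show u - (v + L) = u - v - ((1 : ℤ) : ℝ) * L by push_cast; ring])
    have h2 := correlationIntegral_cantorConv_le_mul ha ha' hb hb' (t * Real.exp (v + L)) hr
    rw [hstep, add_sub_cancel_right] at h2
    refine h1.trans ((mul_le_mul_right h2 16).trans ?_)
    rw [← mul_assoc]
    gcongr
    norm_num

/-- The correlation integral at scale `a^{Nk}` is bounded by the product of the correlation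
integrals at scale `a^N` along an orbit of a rotation. -/
lemma exists_correlationIntegral_le_prod (ha : 0 < a) (ha' : a < 1 / 2) (hb : 0 < b)
    (hb' : b < 1 / 2) (hL : Real.exp (-L) = b) (t : ℝ) :
    ∃ K : ℝ, 0 < K ∧ ∀ (N k : ℕ) (y : AddCircle L),
      circleCorrelation a b t ((a ^ N) ^ k) L y ≤ ∏ i ∈ Finset.range k, (ENNReal.ofReal K *
        circleCorrelation a b t (a ^ N) L
          (y + (i : ℤ) • ((N * -Real.log a : ℝ) : AddCircle L))) := by
  have hL0 : 0 < L := Fact.out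
  obtain ⟨K, hK, h⟩ := exists_correlationIntegral_cantorConv_mul_le ha ha' hb hb' |t|
  refine ⟨K, hK, fun N k => ?_⟩
  set θ : ℝ := N * -Real.log a with hθ
  have hθ0 : 0 ≤ θ := mul_nonneg (Nat.cast_nonneg N)
    (neg_nonneg.2 (Real.log_nonpos ha.le (by linarith)))
  have haN : Real.exp θ = (a ^ N)⁻¹ := by
    rw [hθ, mul_neg, Real.exp_neg, ← Real.log_pow, Real.exp_log (by positivity)]
  induction k with
  | zero =>
    intro y
    have := isProbabilityMeasure_cantorConv ha ha' hb hb' (t * Real.exp (circleRep L y))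
    simpa [circleCorrelation] using correlationIntegral_le_one _ _
  | succ k ih =>
    intro y
    set u := circleRep L y with hu
    set v := circleRep L (y + (θ : AddCircle L)) with hv
    have hum := circleRep_mem y
    have hvm := circleRep_mem (y + (θ : AddCircle L))
    -- The number of turns made by the rotation step. It serves as the number of digits removed from
    -- `μ_b`, which keeps the new ratio in the fundamental domain; it must be nonnegative, which
    -- follows from `θ ≥ 0`, `u > -L` and `v ≤ 0`.
    obtain ⟨n, hn⟩ : ∃ n : ℤ, u + θ - v = n * L := by
      have : ((u + θ - v : ℝ) : AddCircle L) = 0 := by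
        rw [AddCircle.coe_sub, AddCircle.coe_add, hu, hv, coe_circleRep, coe_circleRep, sub_self]
      obtain ⟨n, hn⟩ := (AddCircle.coe_eq_zero_iff L).1 this
      exact ⟨n, by rw [← hn, zsmul_eq_mul]⟩
    have hn0 : 0 ≤ n := by
      have : (-1 : ℝ) * L < n * L := by linarith [hum.1, hvm.2]
      have : (-1 : ℝ) < n := lt_of_mul_lt_mul_right this hL0.le
      have : (-1 : ℤ) < n := by exact_mod_cast this
      omega
    lift n to ℕ using hn0
    rw [Int.cast_natCast] at hn
    have hv2 : t * Real.exp u * b ^ n / a ^ N = t * Real.exp v := by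
      have e1 : v = u + n * -L + θ := by linarith
      rw [e1, Real.exp_add, Real.exp_add, Real.exp_nat_mul, hL, haN]
      ring
    have hB : |t * Real.exp u * b ^ n / a ^ N| ≤ |t| := by
      rw [hv2, abs_mul, Real.abs_exp]
      exact mul_le_of_le_one_right (abs_nonneg t) (Real.exp_le_one_iff.2 hvm.2)
    have h1 := h N n (t * Real.exp u) hB ((a ^ N) ^ k) (by positivity)
      (pow_le_one₀ (by positivity) (pow_le_one₀ ha.le (by linarith)))
    rw [hv2, ← pow_succ'] at h1
    rw [Finset.prod_range_succ', mul_comm]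
    refine h1.trans ?_
    have h2 := ih (y + (θ : AddCircle L))
    have h3 : ∀ i : ℕ, y + (θ : AddCircle L) + (i : ℤ) • (θ : AddCircle L)
        = y + ((i + 1 : ℕ) : ℤ) • (θ : AddCircle L) := fun i => by
      push_cast
      rw [add_smul, one_smul]
      abel
    simp_rw [h3] at h2
    simp only [Nat.cast_zero, zero_smul, add_zero]
    exact mul_le_mul' le_rfl h2

/-- AM-GM. It allows the correlation integrals themselves, rather than their logarithms, to be
averaged along the orbit. -/
lemma prod_le_pow_of_sum_le {k : ℕ} {f : ℕ → ℝ≥0∞} {q : ℝ≥0∞} (hf : ∀ i, f i ≠ ⊤)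
    (hq : q ≠ ⊤) (h : ∑ i ∈ Finset.range k, f i ≤ k * q) :
    ∏ i ∈ Finset.range k, f i ≤ q ^ k := by
  rcases Nat.eq_zero_or_pos k with rfl | hk
  · simp
  have hk' : (0 : ℝ) < k := by exact_mod_cast hk
  lift f to ℕ → ℝ≥0 using hf
  lift q to ℝ≥0 using hq
  beta_reduce at h ⊢
  have h' : ∑ i ∈ Finset.range k, (f i : ℝ) ≤ k * q := by exact_mod_cast h
  have h1 := Real.geom_mean_le_arith_mean (Finset.range k) (fun _ => 1) (fun i => (f i : ℝ))
    (by simp) (by simpa using hk) (by simp)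
  simp only [Real.rpow_one, one_mul, Finset.sum_const, Finset.card_range, nsmul_eq_mul,
    mul_one] at h1
  have h2 : (∏ i ∈ Finset.range k, (f i : ℝ)) ^ ((k : ℝ)⁻¹) ≤ q :=
    h1.trans ((div_le_iff₀ hk').2 (by rwa [mul_comm] at h'))
  have h3 : ∏ i ∈ Finset.range k, (f i : ℝ) ≤ (q : ℝ) ^ k := by
    have h4 := Real.rpow_le_rpow (by positivity) h2 hk'.le
    rwa [← Real.rpow_mul (by positivity), inv_mul_cancel₀ hk'.ne', Real.rpow_one,
      Real.rpow_natCast] at h4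
  exact_mod_cast h3

end Orbit

/-! ### Power decay of the correlation integral for each nonzero ratio. -/

section PowerBound

variable {a b : ℝ}

/-- The correlation integrals of `cantorConv a b t` decay along a geometric sequence of scales, at
every exponent less than `min (cantorDim a + cantorDim b) 1`. -/
lemma exists_correlationIntegral_cantorConv_pow_le (ha : 0 < a) (ha' : a < 1 / 2) (hb : 0 < b)
    (hb' : b < 1 / 2) (hab : Irrational (Real.log b / Real.log a)) {t s : ℝ} (ht : t ≠ 0)
    (hs : s < min (cantorDim a + cantorDim b) 1) :
    ∃ N k₀ : ℕ, N ≠ 0 ∧ ∀ k : ℕ, k₀ ≤ k →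
      correlationIntegral (cantorConv a b t) ((a ^ N) ^ k)
        ≤ ENNReal.ofReal ((a ^ N) ^ s) ^ k := by
  set α := min (cantorDim a + cantorDim b) 1 with hα
  have hlb : Real.log b < 0 := Real.log_neg hb (by linarith)
  have hla : Real.log a < 0 := Real.log_neg ha (by linarith)
  obtain ⟨L, hLdef⟩ : ∃ L, L = -Real.log b := ⟨_, rfl⟩
  have hL0 : 0 < L := by linarith
  have : Fact (0 < L) := ⟨hL0⟩
  have hL : Real.exp (-L) = b := by rw [hLdef, neg_neg, Real.exp_log hb]
  obtain ⟨K₁, hK₁, h1⟩ := exists_setLIntegral_correlationIntegral_le ha ha' hb hb' ht hL0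
    (min_le_right _ _) (min_le_left _ _ : α ≤ cantorDim a + cantorDim b)
  rw [← hα] at h1
  obtain ⟨K₂, hK₂, h2⟩ := exists_correlationIntegral_le_prod ha ha' hb hb' hL t
  -- The cost of one orbit step: `K₂` from submultiplicativity, `2 * 1024` from the averaging, `K₁`
  -- from transversality, `L` from normalizing the space average. None depends on `N`, so the gap `α
  -- - s` beats them and the factor `N + 1`.
  set M : ℝ := K₂ * (2 * 1024 * K₁ / L) with hM
  have hMpos : 0 < M := by positivity
  have hq : 0 < a ^ (α - s) := Real.rpow_pos_of_pos ha _
  have hq1 : a ^ (α - s) < 1 := Real.rpow_lt_one ha.le (by linarith) (by linarith)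
  obtain ⟨N, hN0, hN⟩ : ∃ N : ℕ, N ≠ 0 ∧ M * (N + 1) * (a ^ α) ^ N ≤ (a ^ N) ^ s := by
    have hlim : Tendsto (fun N : ℕ => M * (N * (a ^ (α - s)) ^ N + (a ^ (α - s)) ^ N)) atTop
        (𝓝 (M * (0 + 0))) :=
      ((tendsto_self_mul_const_pow_of_lt_one hq.le hq1).add
        (tendsto_pow_atTop_nhds_zero_of_lt_one hq.le hq1)).const_mul M
    rw [add_zero, mul_zero] at hlim
    obtain ⟨N, hN, hN0⟩ := ((hlim.eventually_lt_const one_pos).and (eventually_ne_atTop 0)).exists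
    refine ⟨N, hN0, ?_⟩
    have e1 : (a ^ α) ^ N = (a ^ (α - s)) ^ N * (a ^ N) ^ s := by
      rw [← Real.rpow_natCast, ← Real.rpow_natCast, ← Real.rpow_natCast, ← Real.rpow_mul ha.le,
        ← Real.rpow_mul ha.le, ← Real.rpow_mul ha.le, ← Real.rpow_add ha]
      congr 1; ring
    have e2 : 0 < (a ^ N) ^ s := by positivity
    calc M * (N + 1) * (a ^ α) ^ N
        = M * (N * (a ^ (α - s)) ^ N + (a ^ (α - s)) ^ N) * (a ^ N) ^ s := by rw [e1]; ring
      _ ≤ 1 * (a ^ N) ^ s := by gcongr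
      _ = _ := one_mul _
  have hβ : Irrational ((N * -Real.log a : ℝ) / L) := by
    have e : (N * -Real.log a : ℝ) / L = N * (Real.log b / Real.log a)⁻¹ := by
      rw [hLdef, inv_div]
      field_simp
    rw [e]
    exact hab.inv.natCast_mul hN0
  obtain ⟨δ, hδ, hδF⟩ := exists_circleCorrelation_le ha ha' hb hb' hL t (r := a ^ N) (by positivity)
  obtain ⟨k₀, hk₀⟩ := exists_sum_rotation_le hβ hδ
    (measurable_circleCorrelation ha ha' hb hb' t (a ^ N)) (by simp) hδF
  refine ⟨N, k₀, hN0, fun k hk => ?_⟩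
  -- The point `0` of the circle corresponds to the ratio `t` itself; uniformity over starting
  -- points permits this choice.
  have h3 := hk₀ k hk 0
  rw [lintegral_circleCorrelation] at h3
  have h4 := h3.trans (mul_le_mul_right (h1 N) _)
  have hrep : circleRep L 0 = 0 := by
    have := circleRep_coe (L := L) (x := 0) ⟨by linarith, le_rfl⟩
    simpa using this
  have h5 := h2 N k 0
  conv_lhs at h5 => rw [circleCorrelation, hrep, Real.exp_zero, mul_one]
  refine h5.trans ((prod_le_pow_of_sum_le (q := ENNReal.ofReal (M * (N + 1) * (a ^ α) ^ N))
    (fun i => ?_) ENNReal.ofReal_ne_top ?_).trans ?_)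
  · refine ENNReal.mul_ne_top ENNReal.ofReal_ne_top ?_
    have := isProbabilityMeasure_cantorConv ha ha' hb hb'
      (t * Real.exp (circleRep L (0 + (i : ℤ) • ((N * -Real.log a : ℝ) : AddCircle L))))
    exact ne_top_of_le_ne_top ENNReal.one_ne_top (correlationIntegral_le_one _ _)
  · rw [← Finset.mul_sum]
    have hLne : ENNReal.ofReal L ≠ 0 := by simpa using hL0
    rw [← ENNReal.mul_le_mul_iff_right hLne ENNReal.ofReal_ne_top, mul_left_comm]
    refine (mul_le_mul_right h4 _).trans (le_of_eq ?_)
    have e1 : (2 : ℝ≥0∞) * 1024 = ENNReal.ofReal (2 * 1024) := by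
      rw [ENNReal.ofReal_mul two_pos.le, ENNReal.ofReal_ofNat, ENNReal.ofReal_ofNat]
    have hp : 0 < a ^ α := Real.rpow_pos_of_pos ha _
    rw [e1, ← ENNReal.ofReal_natCast, ← ENNReal.ofReal_mul (by positivity),
      ← ENNReal.ofReal_mul (by positivity), ← ENNReal.ofReal_mul (by positivity),
      ← ENNReal.ofReal_mul (by positivity), ← ENNReal.ofReal_mul (by positivity)]
    congr 1
    rw [hM]
    field_simp
  · gcongr

/-- The correlation integral of `cantorConv a b t` is `O(r^s)` for every exponent `s` less than
`min (cantorDim a + cantorDim b) 1`. -/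
lemma exists_correlationIntegral_cantorConv_le (ha : 0 < a) (ha' : a < 1 / 2) (hb : 0 < b)
    (hb' : b < 1 / 2) (hab : Irrational (Real.log b / Real.log a)) {t s : ℝ} (ht : t ≠ 0)
    (hs0 : 0 ≤ s) (hs : s < min (cantorDim a + cantorDim b) 1) :
    ∃ K r₀ : ℝ, 0 < K ∧ 0 < r₀ ∧ ∀ r : ℝ, 0 < r → r ≤ r₀ →
      correlationIntegral (cantorConv a b t) r ≤ ENNReal.ofReal (K * r ^ s) := by
  obtain ⟨N, k₀, hN, h⟩ := exists_correlationIntegral_cantorConv_pow_le ha ha' hb hb' hab ht hs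
  set q : ℝ := a ^ N with hq
  have hq0 : 0 < q := by positivity
  have hq1 : q < 1 := pow_lt_one₀ ha.le (by linarith) hN
  -- The factor `(q⁻¹) ^ s` pays for rounding `r` up to a power of `q`; below `q ^ k₀` the geometric
  -- bound is available.
  refine ⟨(q⁻¹) ^ s, q ^ k₀, by positivity, by positivity, fun r hr hr' => ?_⟩
  obtain ⟨k, hk1, hk2⟩ := exists_nat_pow_near_of_lt_one hr
    (hr'.trans (pow_le_one₀ hq0.le hq1.le)) hq0 hq1
  have hk : k₀ ≤ k := by
    by_contra! hlt
    have := pow_le_pow_of_le_one hq0.le hq1.le (Nat.succ_le_of_lt hlt)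
    exact absurd (hk1.trans_le hr') (not_lt.2 this)
  refine (correlationIntegral_mono _ hk2).trans ((h k hk).trans ?_)
  rw [← ENNReal.ofReal_pow (by positivity)]
  apply ENNReal.ofReal_le_ofReal
  rw [← Real.mul_rpow (by positivity) hr.le, ← Real.rpow_natCast, ← Real.rpow_mul hq0.le,
    mul_comm s, Real.rpow_mul hq0.le, Real.rpow_natCast]
  refine Real.rpow_le_rpow (by positivity) ?_ hs0
  rw [inv_mul_eq_div, le_div_iff₀ hq0, ← pow_succ]
  exact hk1.le

end PowerBound

/-! ### From power bounds to the correlation dimension. -/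

section CorrelationDimension

/-- After division by `log r → -∞` the multiplicative constants disappear, so upper bounds at all
exponents below `α` suffice. The sign of `log r` reverses the inequalities. -/
lemma hasCorrelationDim_of_power_bounds {ν : Measure ℝ} [IsProbabilityMeasure ν] {α c : ℝ}
    (hα : 0 < α) (hc : 0 < c)
    (hlow : ∀ r : ℝ, 0 < r → r ≤ 1 → ENNReal.ofReal (c * r ^ α) ≤ correlationIntegral ν r)
    (hup : ∀ s : ℝ, 0 ≤ s → s < α → ∃ K r₀ : ℝ, 0 < K ∧ 0 < r₀ ∧ ∀ r : ℝ, 0 < r → r ≤ r₀ →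
      correlationIntegral ν r ≤ ENNReal.ofReal (K * r ^ s)) :
    HasCorrelationDim ν (α : EReal) := by
  set g : ℝ → ℝ := fun r => Real.log (correlationIntegral ν r).toReal / Real.log r with hg
  have hfin : ∀ r, correlationIntegral ν r ≠ ⊤ := fun r =>
    ne_top_of_le_ne_top ENNReal.one_ne_top (correlationIntegral_le_one ν r)
  have hpos : ∀ r : ℝ, 0 < r → r ≤ 1 → 0 < (correlationIntegral ν r).toReal := fun r hr hr1 =>
    ENNReal.toReal_pos ((lt_of_lt_of_le (by simp; positivity) (hlow r hr hr1)).ne') (hfin r)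
  have hfg : ∀ᶠ r in 𝓝[>] (0 : ℝ), ENNReal.log (correlationIntegral ν r)
      / ((Real.log r : ℝ) : EReal) = ((g r : ℝ) : EReal) := by
    filter_upwards [Ioc_mem_nhdsGT (zero_lt_one : (0 : ℝ) < 1)] with r hr
    rw [hg, EReal.coe_div, ENNReal.log_pos_real' (hpos r hr.1 hr.2)]
  have hlogr : ∀ M : ℝ, ∀ ε : ℝ, 0 < ε → ∀ᶠ r in 𝓝[>] (0 : ℝ), M / Real.log r < ε := by
    intro M ε hε
    have : Tendsto (fun r : ℝ => M / Real.log r) (𝓝[>] 0) (𝓝 0) :=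
      tendsto_const_nhds.div_atBot Real.tendsto_log_nhdsGT_zero
    exact this.eventually_lt_const hε
  have hge : ∀ s : ℝ, s < α → ∀ᶠ r in 𝓝[>] (0 : ℝ), s ≤ g r := by
    intro s hs
    -- An exponent strictly between `s` and `α`, leaving room to absorb `log K / log r`; the maximum
    -- keeps it nonnegative when `s` is very negative.
    set s' := max 0 ((s + α) / 2) with hs'
    have h1 : s' < α := max_lt hα (by linarith)
    have h2 : s < s' := lt_of_lt_of_le (by linarith) (le_max_right _ _)
    obtain ⟨K, r₀, hK, hr₀, h⟩ := hup s' (le_max_left _ _) h1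
    filter_upwards [Ioo_mem_nhdsGT (lt_min hr₀ zero_lt_one), hlogr (-Real.log K) (s' - s) (by linarith)]
      with r hr hlim
    have hr1 : r < 1 := hr.2.trans_le (min_le_right _ _)
    have hlog : Real.log r < 0 := Real.log_neg hr.1 hr1
    have hle := ENNReal.toReal_mono ENNReal.ofReal_ne_top
      (h r hr.1 (hr.2.le.trans (min_le_left _ _)))
    have hrs := Real.rpow_pos_of_pos hr.1 s'
    rw [ENNReal.toReal_ofReal (by positivity)] at hle
    have hlog2 := Real.log_le_log (hpos r hr.1 hr1.le) hle
    rw [Real.log_mul hK.ne' hrs.ne', Real.log_rpow hr.1] at hlog2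
    rw [hg, le_div_iff_of_neg hlog]
    rw [div_lt_iff_of_neg hlog] at hlim
    linarith
  have hle : ∀ s : ℝ, α < s → ∀ᶠ r in 𝓝[>] (0 : ℝ), g r ≤ s := by
    intro s hs
    filter_upwards [Ioo_mem_nhdsGT zero_lt_one, hlogr (Real.log c) (s - α) (by linarith)]
      with r hr hlim
    have hlog : Real.log r < 0 := Real.log_neg hr.1 hr.2
    have hle := ENNReal.toReal_mono (hfin r) (hlow r hr.1 hr.2.le)
    have hrs := Real.rpow_pos_of_pos hr.1 α
    rw [ENNReal.toReal_ofReal (by positivity)] at hle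
    have hlog2 := Real.log_le_log (by positivity) hle
    rw [Real.log_mul hc.ne' hrs.ne', Real.log_rpow hr.1] at hlog2
    rw [hg, div_le_iff_of_neg hlog]
    rw [div_lt_iff_of_neg hlog] at hlim
    linarith
  have hlim : Tendsto g (𝓝[>] 0) (𝓝 α) := by
    refine tendsto_order.2 ⟨fun s hs => ?_, fun s hs => ?_⟩
    · exact (hge ((s + α) / 2) (by linarith)).mono fun r hr => by linarith
    · exact (hle ((s + α) / 2) (by linarith)).mono fun r hr => by linarith
  have hlim' : Tendsto (fun r : ℝ => ENNReal.log (correlationIntegral ν r)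
      / ((Real.log r : ℝ) : EReal)) (𝓝[>] 0) (𝓝 (α : EReal)) :=
    ((continuous_coe_real_ereal.tendsto α).comp hlim).congr' (hfg.mono fun r hr => hr.symm)
  exact ⟨hlim'.liminf_eq, hlim'.limsup_eq⟩

end CorrelationDimension

/-! ### The main theorem. -/

theorem mainTheorem2 (a b t : ℝ) (ha : 0 < a) (ha' : a < 1 / 2) (hb : 0 < b) (hb' : b < 1 / 2)
    (hab : Irrational (Real.log b / Real.log a)) (ht : t ≠ 0) :
    HasCorrelationDim (cantorConv a b t)
        ((min (dimH (centralCantorSet a) + dimH (centralCantorSet b)) 1 : ℝ≥0∞) : EReal) ∧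
      measureHausdorffDim (cantorConv a b t) =
        min (dimH (centralCantorSet a) + dimH (centralCantorSet b)) 1 ∧
      measurePackingDim (cantorConv a b t) =
        min (dimH (centralCantorSet a) + dimH (centralCantorSet b)) 1 := by
  have := isProbabilityMeasure_cantorConv ha ha' hb hb' t
  have hda := cantorDim_pos ha ha'
  have hdb := cantorDim_pos hb hb'
  set α := min (cantorDim a + cantorDim b) 1 with hα
  have hα0 : 0 < α := lt_min (by positivity) one_pos
  have hmin : min (dimH (centralCantorSet a) + dimH (centralCantorSet b)) 1
      = ENNReal.ofReal α := by
    rw [dimH_centralCantorSet ha ha', dimH_centralCantorSet hb hb',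
      ← ENNReal.ofReal_add hda.le hdb.le, ← ENNReal.ofReal_one, hα]
    exact (ENNReal.ofReal_mono.map_min).symm
  set A := Set.image2 (fun x y => x + t * y) (centralCantorSet a) (centralCantorSet b) with hA
  have hAae : ∀ᵐ x ∂cantorConv a b t, x ∈ A := ae_mem_image2_cantorConv ha ha' hb hb' t
  have hAbdd : Bornology.IsBounded A := by
    rw [hA, ← Set.image_prod]
    exact (((isCompact_centralCantorSet ha ha').prod (isCompact_centralCantorSet hb hb')).image
      (by fun_prop)).isBounded
  -- If the minimum is the sum of the dimensions, product covers are used; if it is `1`, boundedness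
  -- alone suffices.
  have hbox : HasBoxBound A α := by
    rcases min_choice (cantorDim a + cantorDim b) 1 with h | h
    · rw [hα, h]
      exact (hasBoxBound_centralCantorSet ha ha').image2_add_mul
        (hasBoxBound_centralCantorSet hb hb') t
    · rw [hα, h]
      exact hasBoxBound_one_of_isBounded hAbdd
  have hup := fun s (hs0 : (0 : ℝ) ≤ s) (hs : s < α) =>
    exists_correlationIntegral_cantorConv_le ha ha' hb hb' hab ht hs0 hs
  have hdimH : ∀ E : Set ℝ, cantorConv a b t Eᶜ = 0 → ENNReal.ofReal α ≤ dimH E := by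
    intro E hE
    refine le_of_forall_lt fun x hx => ?_
    obtain ⟨s, hxs, hsα⟩ := ENNReal.lt_iff_exists_nnreal_btwn.1 hx
    have hs0 : (0 : ℝ) < s := by
      have : (0 : ℝ≥0∞) < s := lt_of_le_of_lt zero_le hxs
      exact_mod_cast this
    have hsα' : (s : ℝ) < α := by
      rwa [← ENNReal.ofReal_coe_nnreal, ENNReal.ofReal_lt_ofReal_iff hα0] at hsα
    obtain ⟨K, r₀, hK, hr₀, h⟩ := hup ((s + α) / 2) (by positivity) (by linarith)
    have := ofReal_le_dimH_of_correlationIntegral_le hs0 (by linarith : (s : ℝ) < (s + α) / 2)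
      hr₀ h hE
    rw [ENNReal.ofReal_coe_nnreal] at this
    exact hxs.trans_le this
  have hpack : packingDim A ≤ ENNReal.ofReal α :=
    (packingDim_le_upperMinkowskiDim hAbdd).trans (hbox.upperMinkowskiDim_le hα0.le)
  rw [hmin]
  refine ⟨?_, le_antisymm ?_ ?_, le_antisymm ?_ ?_⟩
  · obtain ⟨c, hc, hlow⟩ := hbox.exists_le_correlationIntegral hAae
    have h := hasCorrelationDim_of_power_bounds hα0 hc hlow hup
    rwa [EReal.coe_ennreal_ofReal, max_eq_left hα0.le]
  · exact (iInf₂_le A hAae).trans ((dimH_le_packingDim A).trans hpack)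
  · exact le_iInf₂ hdimH
  · exact (iInf₂_le A hAae).trans hpack
  · exact le_iInf₂ fun E hE => (hdimH E hE).trans (dimH_le_packingDim E)
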